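/- Let $V=\ell^2(\mathbb{Z}_{\ge 0})$ be the real Hilbert space with orthonormal basis $e_0,e_1,\dots$. A (four-leg Hilbert–Schmidt) tensor is a real table $A=(A_{ijkl})_{i,j,k,l\ge 0}$ with $\|A\|=\big(\sum_{ijkl}A_{ijkl}^2\big)^{1/2}<\infty$, the indices $i,j,k,l$ sitting on the right, top, left and bottom leg, respectively. It is normalized if $A_{0000}=1$. Let $A_*$ be the tensor whose only nonzero component is $(A_*)_{0000}=1$. Let $J_1,J_2:V\to V\otimes V$ be isometric isomorphisms with $J_ae_0=e_0\otimes e_0$. The block $T(A)$ of a tensor $A$ is the contraction of four copies of $A$ placed in a $2\times2$ square; it is a tensor on $V\otimes V$. For an operator $F$ that is invertible with bounded inverse, to conjugate the horizontal (vertical) legs of a tensor by $F$ means to contract $F$ with the right (top) leg and $F^{-1}$ with the left (bottom) leg. Consider the following steps. - Gauge step: choose bounded invertible operators $G_h,G_v$ on $V$, and conjugate the horizontal legs of $A$ by $G_h$ and the vertical legs by $G_v$. - Type I step: replace $A$ by $T(A)$, with all legs brought back to $V$ by conjugating the horizontal and the vertical legs by $J_1$. - Type II step: choose a bounded invertible operator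 $R$ on $V\otimes V$, and let $S=R^{-1}T(A)R$ be $T(A)$ with its horizontal legs conjugated by $R$. Choose Hilbert–Schmidt tensors $S_u$ (the upper half: one right leg, one left leg, two top legs, one bottom leg) and $S_d$ (the lower half: one right leg, one left leg, one top leg, two bottom legs), with all legs in $V$, such that $S$ is the contraction of $S_u$ placed above $S_d$ over the single bond between them. Replace $A$ by the contraction of $S_d$ placed above $S_u$ over the two bonds between them, with its horizontal legs brought back to $V$ by conjugation by $J_2$. Theorem. There is a constant $C>0$, independent of $J_1$ and $J_2$, such that for all $J_1,J_2$ as above the following holds. To every normalized tensor $A=A_*+\delta A$ with $\|\delta A\|<1/C^2$ one can apply a gauge step, then a type I step, then a type II step (with suitable choices of $G_h,G_v,R,S_u,S_d$ depending on $A$) such that the $0000$ component of the result is nonzero and division by that component gives a normalized tensor $A'=A_*+\delta A'$ with $$\|\delta A'\|\le C\,\|\delta A\|^{3/2}.$$ Moreover, these choices define a map $A\mapsto A'$ whose iterates $A^{(n)}$, started from any normalized $A^{(0)}=A=A_*+\delta A$ with $\|\delta A\|<1/C^2$, converge super-exponentially to $A_*$ in Hilbert–Schmidt norm: for all $n\ge0$,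 $$\|A^{(n)}-A_*\|\le C^{-2}\big(C^2\|\delta A\|\big)^{(3/2)^n},$$ and consequently $\|A^{(n)}-A_*\|/q^n\to0$ as $n\to\infty$ for every $q>0$. -/

import Mathlib

open Filter Topology

noncomputable section

/-- Real Hilbert–Schmidt tables indexed by `ι`: square-summable families `ι → ℝ`, with the norm
`(∑ x_i ^ 2) ^ (1/2)`.  `HS ℕ` is the bond space `V = ℓ²(ℕ)`, and `HS (ℕ × ℕ)` is the Hilbert
tensor product `V ⊗ V`, with orthonormal basis `e_i ⊗ e_j`. -/
abbrev HS (ι : Type) : Type := lp (fun _ : ι => ℝ) 2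

/-- The basis vector of `HS ι` with index `i`. -/
def basisVec {ι : Type} [DecidableEq ι] (i : ι) : HS ι := lp.single 2 i (1 : ℝ)

/-- Four-leg Hilbert–Schmidt tensors on `ℓ²(ℕ)`.  The component with indices
`(i, j, k, l)` has `i, j, k, l` on the right, top, left and bottom leg, respectively. -/
abbrev Tensor4 : Type := HS (ℕ × ℕ × ℕ × ℕ)

/-- The high-temperature fixed point `A_*`: the only nonzero component is the `0000` one, equal
to `1`. -/
def fixedTensor : Tensor4 := basisVec (0, 0, 0, 0)

/-- `entry F k i = ⟨k| F |i⟩`, the matrix element of a bounded operator. -/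
def entry {ι κ : Type} [DecidableEq ι] (F : HS ι →L[ℝ] HS κ) (k : κ) (i : ι) : ℝ :=
  F (basisVec i) k

/-- `F⁻¹ T F` along the horizontal bonds: `F` is contracted with the right leg of `T` and `F⁻¹`
with its left leg.  The left leg is the row index, the right leg the column index. -/
def conjH {α α' β : Type} [DecidableEq α] [DecidableEq α'] (F : HS α' ≃L[ℝ] HS α)
    (T : α × β × α × β → ℝ) : α' × β × α' × β → ℝ :=
  fun (i, j, k, l) => ∑' p : α × α,
    entry (F.symm : HS α →L[ℝ] HS α') k p.1 * T (p.2, j, p.1, l) *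
      entry (F : HS α' →L[ℝ] HS α) p.2 i

/-- `F⁻¹ T F` along the vertical bonds: `F` is contracted with the top leg of `T` and `F⁻¹` with
its bottom leg. -/
def conjV {α β β' : Type} [DecidableEq β] [DecidableEq β'] (F : HS β' ≃L[ℝ] HS β)
    (T : α × β × α × β → ℝ) : α × β' × α × β' → ℝ :=
  fun (i, j, k, l) => ∑' p : β × β,
    entry (F.symm : HS β →L[ℝ] HS β') l p.1 * T (i, p.2, k, p.1) *
      entry (F : HS β' →L[ℝ] HS β) p.2 j

/-- The contraction of four copies of `A` in a two-by-two block.  A pair of indices on a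
horizontal leg is ordered (upper bond, lower bond), on a vertical leg (left bond, right bond).
The summation indices `a, b` are the internal horizontal bonds of the upper and the lower row,
`c, d` the internal vertical bonds of the left and the right column. -/
def block (A : ℕ × ℕ × ℕ × ℕ → ℝ) :
    (ℕ × ℕ) × (ℕ × ℕ) × (ℕ × ℕ) × (ℕ × ℕ) → ℝ :=
  fun ((i₁, i₂), (j₁, j₂), (k₁, k₂), (l₁, l₂)) => ∑' s : ℕ × ℕ × ℕ × ℕ,
    match s with
    | (a, b, c, d) =>
        A (a, j₁, k₁, c) * A (i₁, j₂, a, d) * A (b, c, k₂, l₁) * A (i₂, d, b, l₂)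

/-- An upper half-disc tensor: right leg, two top legs, left leg, one bottom leg. -/
abbrev UpperHalf : Type := HS (ℕ × (ℕ × ℕ) × ℕ × ℕ)

/-- A lower half-disc tensor: right leg, one top leg, left leg, two bottom legs. -/
abbrev LowerHalf : Type := HS (ℕ × ℕ × ℕ × (ℕ × ℕ))

/-- `S_u` on top of `S_d`, contracted over the single bond joining them. -/
def stackUD (Su : UpperHalf) (Sd : LowerHalf) :
    (ℕ × ℕ) × (ℕ × ℕ) × (ℕ × ℕ) × (ℕ × ℕ) → ℝ :=
  fun ((i₁, i₂), j, (k₁, k₂), l) => ∑' m : ℕ, Su (i₁, j, k₁, m) * Sd (i₂, m, k₂, l)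

/-- `S_d` on top of `S_u`, contracted over the pair of bonds joining them. -/
def stackDU (Sd : LowerHalf) (Su : UpperHalf) :
    (ℕ × ℕ) × ℕ × (ℕ × ℕ) × ℕ → ℝ :=
  fun ((i₁, i₂), j, (k₁, k₂), l) => ∑' c : ℕ × ℕ, Sd (i₁, j, k₁, c) * Su (i₂, c, k₂, l)

/-- Gauge step: bounded invertible operators `G_h`, `G_v` and their inverses are inserted in the
horizontal and in the vertical bonds. -/
def IsGaugeStep (A B : Tensor4) : Prop :=
  ∃ Gh Gv : HS ℕ ≃L[ℝ] HS ℕ, (B : ℕ × ℕ × ℕ × ℕ → ℝ) = conjV Gv (conjH Gh A)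

/-- Type I step: four tensors are contracted to a block, and the legs of the block are brought
back to `V` by the isometric isomorphism `J : V ≃ V ⊗ V`. -/
def IsTypeIStep (J : HS ℕ ≃ₗᵢ[ℝ] HS (ℕ × ℕ)) (A B : Tensor4) : Prop :=
  (B : ℕ × ℕ × ℕ × ℕ → ℝ) =
    conjV J.toContinuousLinearEquiv (conjH J.toContinuousLinearEquiv (block A))

/-- Type II step: four tensors are contracted to a block `T`; a bounded invertible disentangler
`R` of `V ⊗ V` gives `S = R⁻¹ T R`; `S` is represented as the contraction of two
Hilbert–Schmidt half-discs, which are then contracted in the opposite order; the horizontal legs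
of the result are brought back to `V` by `J`. -/
def IsTypeIIStep (J : HS ℕ ≃ₗᵢ[ℝ] HS (ℕ × ℕ)) (A B : Tensor4) : Prop :=
  ∃ (R : HS (ℕ × ℕ) ≃L[ℝ] HS (ℕ × ℕ)) (Su : UpperHalf) (Sd : LowerHalf),
    conjH R (block A) = stackUD Su Sd ∧
    (B : ℕ × ℕ × ℕ × ℕ → ℝ) = conjH J.toContinuousLinearEquiv (stackDU Sd Su)

/-- `A'` arises from `A` by a gauge step, a type I step (with isomorphism `J₁`) and a type II
step (with isomorphism `J₂`), followed by division by the `0000` component, which has to be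
nonzero. -/
def IsTensorRG (J₁ J₂ : HS ℕ ≃ₗᵢ[ℝ] HS (ℕ × ℕ)) (A A' : Tensor4) : Prop :=
  ∃ A₁ A₂ A₃ : Tensor4, IsGaugeStep A A₁ ∧ IsTypeIStep J₁ A₁ A₂ ∧ IsTypeIIStep J₂ A₂ A₃ ∧
    A₃ (0, 0, 0, 0) ≠ 0 ∧ A' = (A₃ (0, 0, 0, 0))⁻¹ • A₃

end

/-! Call an index value 0 trivial and every other value excited. The linear part of the perturbation
is to be confined to ever fewer components, until exchanging the two halves of a block annihilates
it.

Gauge. A shear of the horizontal bonds, built from the components $\delta A_{i000}$ and $\delta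
A_{00k0}$, cancels exactly these to first order. In the type I block, a first-order term has one
perturbed corner and three copies of $A_*$; the perturbed copy has one outer horizontal and one
outer vertical leg, and its inner legs are trivial. If its vertical leg is trivial too, the
component was cancelled by the gauge. Hence after type I, $A=A_*+t+b+w$ with $w$ of second order,
where $t$ (resp. $b$) has its top (resp. bottom) leg excited and the opposite one trivial.

Type II. A row of two copies is $e+u+v+y$, with $e$ the row of $A_*$, $u$, $v$ linear in $t$, $b$,
and $y$ of second order. In a stack of two rows the products $eu$, $ve$, $uu$, $vv$ (upper row
first) vanish, since the shared bond would have to be both trivial and excited. What remains is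
$(e+u+y)(e+v+y)+vu+vy+yu$. If the halves are $e+u+\dots$ above and $e+v+\dots$ below, stacking them
the other way gives $ee+vu+\dots$, without linear terms: $ve=eu=0$ once more. The obstacle is $vu$:
it is a product of two halves of size $\eta$, and keeping it as an extra bond would return an error
of first order. But $vu$ excites only the two left legs together, or only the two right legs
together (`vst_linearRow_linearRow`), so a shear $R$ on the pair of horizontal bonds cancels it to
leading order.

Size of the error. A Hilbert–Schmidt bound on the remainder is not enough, because both halves must
be Hilbert–Schmidt; the remainder is measured instead by `Factors`, the size of its halves. This
size is subadditive (a direct sum of bonds) and is scaled by at most a constant times $\eta$ under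
the rank-one operators of the shear, whose vectors factor through halves of size $\eta$. A product
of norm $O(\eta^3)$ splits into halves $O(\eta^{3/2})$, and the shear acting on a block perturbation
with halves $O(\eta^{1/2})$ also gives $O(\eta^{3/2})$. This is the origin of the exponent $3/2$.
The abstract bound `shearProd_estimate` serves both measures of size: the norm in the gauge step,
`Factors` in the type II step. -/

noncomputable section

/-! ### Square-summable tables: relabelling, operators on a leg, contraction. -/

namespace HS

open Function

variable {α β γ ι κ ρ : Type}

/-- A square-summable family as an element of `HS ι`. -/
def mk (f : ι → ℝ) (h : Summable fun i => f i ^ 2) : HS ι :=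
  ⟨f, memℓp_gen (by simpa using h)⟩

@[simp] theorem mk_apply (f : ι → ℝ) (h : Summable fun i => f i ^ 2) (i : ι) : mk f h i = f i := rfl

@[ext] theorem ext' {x y : HS ι} (h : ∀ i, x i = y i) : x = y := lp.ext (funext h)

@[simp] theorem add_apply (x y : HS ι) (i : ι) : (x + y) i = x i + y i := rfl
@[simp] theorem sub_apply (x y : HS ι) (i : ι) : (x - y) i = x i - y i := rfl
@[simp] theorem smul_apply (c : ℝ) (x : HS ι) (i : ι) : (c • x) i = c * x i := rfl
@[simp] theorem zero_apply (i : ι) : (0 : HS ι) i = 0 := rfl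

theorem hasSum_sq (x : HS ι) : HasSum (fun i => x i ^ 2) (‖x‖ ^ 2) := by
  have := lp.hasSum_norm (p := 2) (by norm_num) x
  simpa using this

theorem summable_sq (x : HS ι) : Summable fun i => x i ^ 2 := (hasSum_sq x).summable

theorem norm_sq (x : HS ι) : ‖x‖ ^ 2 = ∑' i, x i ^ 2 := (hasSum_sq x).tsum_eq.symm

theorem abs_apply_le (x : HS ι) (i : ι) : |x i| ≤ ‖x‖ := lp.norm_apply_le_norm (by norm_num) x i

theorem norm_le_of_sq_le {x : HS ι} {c : ℝ} (hc : 0 ≤ c) (h : ‖x‖ ^ 2 ≤ c ^ 2) : ‖x‖ ≤ c :=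
  (sq_le_sq₀ (norm_nonneg _) hc).1 h

theorem inner_eq (x y : HS ι) : inner ℝ x y = ∑' i, x i * y i := by
  rw [lp.inner_eq_tsum]
  exact tsum_congr fun i => mul_comm _ _

theorem summable_mul (x y : HS ι) : Summable fun i => x i * y i := by
  have := lp.summable_inner (𝕜 := ℝ) y x
  exact this

theorem abs_tsum_mul_le (x y : HS ι) : |∑' i, x i * y i| ≤ ‖x‖ * ‖y‖ := by
  rw [← inner_eq]
  exact abs_real_inner_le_norm x y

theorem basisVec_apply [DecidableEq ι] (i j : ι) :
    (basisVec i : HS ι) j = if j = i then 1 else 0 := by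
  simp [basisVec, Pi.single_apply]

@[simp] theorem norm_basisVec [DecidableEq ι] (i : ι) : ‖(basisVec i : HS ι)‖ = 1 := by
  simp [basisVec, lp.norm_single]

theorem inner_basisVec_left [DecidableEq ι] (i : ι) (x : HS ι) :
    inner ℝ (basisVec i) x = x i := by
  have := lp.inner_single_left (𝕜 := ℝ) i (1 : ℝ) x
  simpa [basisVec] using this

/-- Pull-back of a table along an injective map of index sets. -/
def pull (f : ι → κ) (hf : Injective f) : HS κ →ₗ[ℝ] HS ι where
  toFun x := mk (fun i => x (f i)) ((summable_sq x).comp_injective hf)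
  map_add' _ _ := rfl
  map_smul' _ _ := rfl

@[simp] theorem pull_apply (f : ι → κ) (hf : Injective f) (x : HS κ) (i : ι) :
    pull f hf x i = x (f i) := rfl

theorem norm_pull_le (f : ι → κ) (hf : Injective f) (x : HS κ) : ‖pull f hf x‖ ≤ ‖x‖ := by
  refine norm_le_of_sq_le (norm_nonneg _) ?_
  rw [norm_sq, norm_sq]
  exact (summable_sq (pull f hf x)).tsum_le_tsum_of_inj f hf (fun _ _ => sq_nonneg _)
    (fun _ => le_rfl) (summable_sq x)

/-- Push-forward (extension by zero) of a table along an injective map of index sets. -/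
def push (f : ι → κ) (hf : Injective f) : HS ι →ₗ[ℝ] HS κ where
  toFun x := mk (extend f x 0) (by
    have : (fun k => extend f (x : ι → ℝ) 0 k ^ 2) = extend f (fun i => x i ^ 2) 0 := by
      funext k
      by_cases h : ∃ i, f i = k
      · obtain ⟨i, rfl⟩ := h
        simp [hf.extend_apply]
      · simp [extend_apply' _ _ _ h]
    rw [this]
    exact (summable_extend_zero hf).2 (summable_sq x))
  map_add' x y := by
    ext k
    by_cases h : ∃ i, f i = k
    · obtain ⟨i, rfl⟩ := h
      simp only [mk_apply, add_apply, hf.extend_apply]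
    · simp only [mk_apply, add_apply, extend_apply' _ _ _ h, Pi.zero_apply, add_zero]
  map_smul' c x := by
    ext k
    by_cases h : ∃ i, f i = k
    · obtain ⟨i, rfl⟩ := h
      simp [hf.extend_apply]
    · simp [extend_apply' _ _ _ h]

@[simp] theorem push_apply (f : ι → κ) (hf : Injective f) (x : HS ι) (i : ι) :
    push f hf x (f i) = x i := hf.extend_apply _ _ _

theorem push_apply_of_notMem (f : ι → κ) (hf : Injective f) (x : HS ι) (k : κ)
    (h : ¬∃ i, f i = k) : push f hf x k = 0 := extend_apply' _ _ _ h

theorem norm_push (f : ι → κ) (hf : Injective f) (x : HS ι) : ‖push f hf x‖ = ‖x‖ := by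
  rw [← sq_eq_sq₀ (norm_nonneg _) (norm_nonneg _), norm_sq, norm_sq]
  rw [← hf.tsum_eq (f := fun k => push f hf x k ^ 2)]
  · simp
  · intro k hk
    by_contra h
    exact hk (by simp [push_apply_of_notMem f hf x k h])

theorem push_basisVec [DecidableEq ι] [DecidableEq κ] (f : ι → κ) (hf : Injective f) (i : ι) :
    push f hf (basisVec i) = basisVec (f i) := by
  ext k
  by_cases h : ∃ i, f i = k
  · obtain ⟨j, rfl⟩ := h
    simp [basisVec_apply, hf.eq_iff]
  · rw [push_apply_of_notMem f hf _ k h, basisVec_apply, if_neg]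
    rintro rfl
    exact h ⟨i, rfl⟩

open Classical in
/-- Restriction of a table to a set of indices. -/
def restr (s : Set ι) : HS ι →ₗ[ℝ] HS ι where
  toFun x := mk (fun i => if i ∈ s then x i else 0) (by
    refine (summable_sq x).of_nonneg_of_le (fun _ => sq_nonneg _) fun i => ?_
    split_ifs
    · exact le_rfl
    · simpa using sq_nonneg _)
  map_add' x y := by
    ext i
    by_cases h : i ∈ s <;> simp [h]
  map_smul' c x := by
    ext i
    by_cases h : i ∈ s <;> simp [h]

open Classical in
theorem restr_apply (s : Set ι) (x : HS ι) (i : ι) :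
    restr s x i = if i ∈ s then x i else 0 := rfl

theorem norm_le_norm {x : HS ι} {y : HS ι} (h : ∀ i, |x i| ≤ |y i|) : ‖x‖ ≤ ‖y‖ := by
  refine norm_le_of_sq_le (norm_nonneg _) ?_
  rw [norm_sq, norm_sq]
  exact (summable_sq x).tsum_le_tsum (fun i => sq_le_sq.2 (h i)) (summable_sq y)

theorem norm_restr_le (s : Set ι) (x : HS ι) : ‖restr s x‖ ≤ ‖x‖ := by
  refine norm_le_norm fun i => ?_
  rw [restr_apply]
  split_ifs <;> simp

theorem hasSum_sq_fibre (x : HS (α × β)) :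
    HasSum (fun a => ‖pull (fun b => (a, b)) (Prod.mk_right_injective a) x‖ ^ 2) (‖x‖ ^ 2) := by
  have h := (hasSum_sq x).prod_fiberwise (g := fun a =>
    ‖pull (fun b => (a, b)) (Prod.mk_right_injective a) x‖ ^ 2) (fun a => by
      exact hasSum_sq (pull (fun b => (a, b)) (Prod.mk_right_injective a) x))
  exact h

theorem hasSum_sq_fibre' (x : HS (α × β)) :
    HasSum (fun b => ‖pull (fun a => (a, b)) (Prod.mk_left_injective b) x‖ ^ 2) (‖x‖ ^ 2) := by
  have h := hasSum_sq_fibre (pull (Prod.swap : β × α → α × β) Prod.swap_injective x)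
  have hn : ‖pull (Prod.swap : β × α → α × β) Prod.swap_injective x‖ = ‖x‖ := by
    refine le_antisymm (norm_pull_le _ _ _) ?_
    exact norm_pull_le (Prod.swap : α × β → β × α) Prod.swap_injective
      (pull (Prod.swap : β × α → α × β) Prod.swap_injective x)
  rw [hn] at h
  exact h

/-- A table whose columns have square-summable norms is square-summable. -/
theorem summable_sq_of_fibres (x : β → HS α) {g : β → ℝ} (hg : Summable g)
    (h : ∀ b, ‖x b‖ ^ 2 ≤ g b) : Summable fun p : α × β => x p.2 p.1 ^ 2 := by
  rw [← (Equiv.prodComm β α).summable_iff]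
  refine (summable_prod_of_nonneg (fun _ => sq_nonneg _)).2 ⟨fun b => summable_sq (x b), ?_⟩
  refine hg.of_nonneg_of_le (fun b => tsum_nonneg fun _ => sq_nonneg _) fun b => ?_
  exact (norm_sq (x b)).symm.le.trans (h b)

/-- A bounded operator acting on the first leg. -/
def legAct (F : HS α →L[ℝ] HS β) : HS (α × ρ) →ₗ[ℝ] HS (β × ρ) where
  toFun x := mk (fun p => F (pull (fun a => (a, p.2)) (Prod.mk_left_injective p.2) x) p.1)
    (summable_sq_of_fibres (fun r => F (pull (fun a => (a, r)) (Prod.mk_left_injective r) x))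
      ((hasSum_sq_fibre' x).summable.mul_left (‖F‖ ^ 2)) fun r => by
        rw [← mul_pow]
        exact pow_le_pow_left₀ (norm_nonneg _) (F.le_opNorm _) 2)
  map_add' x y := by ext p; simp
  map_smul' c x := by ext p; simp

theorem norm_legAct_le (F : HS α →L[ℝ] HS β) (x : HS (α × ρ)) : ‖legAct F x‖ ≤ ‖F‖ * ‖x‖ := by
  refine norm_le_of_sq_le (by positivity) ?_
  rw [mul_pow]
  refine hasSum_le (fun r => ?_) (hasSum_sq_fibre' (legAct F x))
    ((hasSum_sq_fibre' x).mul_left (‖F‖ ^ 2))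
  have h : pull (fun b => (b, r)) (Prod.mk_left_injective r) (legAct F x) =
    F (pull (fun a => (a, r)) (Prod.mk_left_injective r) x) := rfl
  rw [h, ← mul_pow]
  exact pow_le_pow_left₀ (norm_nonneg _) (F.le_opNorm _) 2

/-- Contraction of two tables over one common index. -/
def mul : HS (α × γ) →ₗ[ℝ] HS (γ × β) →ₗ[ℝ] HS (α × β) :=
  LinearMap.mk₂ ℝ
    (fun x y => mk (fun p => ∑' c, x (p.1, c) * y (c, p.2)) (by
      have h := (hasSum_sq_fibre x).summable.mul_of_nonneg (hasSum_sq_fibre' y).summable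
        (fun _ => sq_nonneg _) (fun _ => sq_nonneg _)
      refine h.of_nonneg_of_le (fun _ => sq_nonneg _) fun p => ?_
      rw [← mul_pow, ← sq_abs]
      exact pow_le_pow_left₀ (abs_nonneg _) (abs_tsum_mul_le
        (pull (fun c => (p.1, c)) (Prod.mk_right_injective p.1) x)
        (pull (fun c => (c, p.2)) (Prod.mk_left_injective p.2) y)) 2))
    (fun x x' y => by
      ext p
      simp only [mk_apply, add_apply, add_mul]
      exact (summable_mul (pull (fun c => (p.1, c)) (Prod.mk_right_injective p.1) x)
        (pull (fun c => (c, p.2)) (Prod.mk_left_injective p.2) y)).tsum_add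
        (summable_mul (pull (fun c => (p.1, c)) (Prod.mk_right_injective p.1) x')
        (pull (fun c => (c, p.2)) (Prod.mk_left_injective p.2) y)))
    (fun c x y => by
      ext p
      simp only [mk_apply, smul_apply, mul_assoc, tsum_mul_left])
    (fun x y y' => by
      ext p
      simp only [mk_apply, add_apply, mul_add]
      exact (summable_mul (pull (fun c => (p.1, c)) (Prod.mk_right_injective p.1) x)
        (pull (fun c => (c, p.2)) (Prod.mk_left_injective p.2) y)).tsum_add
        (summable_mul (pull (fun c => (p.1, c)) (Prod.mk_right_injective p.1) x)
        (pull (fun c => (c, p.2)) (Prod.mk_left_injective p.2) y')))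
    (fun c x y => by
      ext p
      simp only [mk_apply, smul_apply, mul_left_comm _ c, tsum_mul_left])

theorem mul_apply (x : HS (α × γ)) (y : HS (γ × β)) (a : α) (b : β) :
    mul x y (a, b) = ∑' c, x (a, c) * y (c, b) := rfl

theorem norm_mul_le (x : HS (α × γ)) (y : HS (γ × β)) : ‖mul x y‖ ≤ ‖x‖ * ‖y‖ := by
  refine norm_le_of_sq_le (by positivity) ?_
  have hx := hasSum_sq_fibre x
  have hy := hasSum_sq_fibre' y
  have h := hx.summable.mul_of_nonneg hy.summable (fun _ => sq_nonneg _) (fun _ => sq_nonneg _)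
  rw [mul_pow, norm_sq, ← hx.tsum_eq, ← hy.tsum_eq, hx.summable.tsum_mul_tsum hy.summable h]
  refine (summable_sq _).tsum_le_tsum (fun p => ?_) h
  rw [← mul_pow, ← sq_abs]
  exact pow_le_pow_left₀ (abs_nonneg _) (abs_tsum_mul_le
    (pull (fun c => (p.1, c)) (Prod.mk_right_injective p.1) x)
    (pull (fun c => (c, p.2)) (Prod.mk_left_injective p.2) y)) 2

/-- The tensor product of two tables. -/
def outer (x : HS α) (y : HS β) : HS (α × β) :=
  mk (fun p => x p.1 * y p.2) (by
    simp only [mul_pow]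
    exact (summable_sq x).mul_of_nonneg (summable_sq y) (fun _ => sq_nonneg _)
      (fun _ => sq_nonneg _))

@[simp] theorem outer_apply (x : HS α) (y : HS β) (p : α × β) :
    outer x y p = x p.1 * y p.2 := rfl

theorem norm_outer (x : HS α) (y : HS β) : ‖outer x y‖ = ‖x‖ * ‖y‖ := by
  rw [← sq_eq_sq₀ (norm_nonneg _) (by positivity), mul_pow, norm_sq, norm_sq, norm_sq,
    (summable_sq x).tsum_mul_tsum (summable_sq y) ((summable_sq x).mul_of_nonneg (summable_sq y)
      (fun _ => sq_nonneg _) (fun _ => sq_nonneg _))]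
  simp [mul_pow]

/-- Each of the pairs $w,z$ and $x,y$ involves all four summation indices exactly once, so the sum
is an inner product of the square-summable tables $w\otimes z$ and $x\otimes y$, hence absolutely
convergent. -/
theorem summable_cyclic {δ : Type} (w : HS (α × γ)) (x : HS (α × δ)) (y : HS (β × γ))
    (z : HS (β × δ)) :
    Summable (fun s : (γ × δ) × (α × β) =>
      (w (s.2.1, s.1.1) * x (s.2.1, s.1.2)) * (y (s.2.2, s.1.1) * z (s.2.2, s.1.2))) := by
  have h := summable_mul
    (pull (fun s : (γ × δ) × (α × β) => ((s.2.1, s.1.1), (s.2.2, s.1.2)))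
      (by rintro ⟨⟨a, b⟩, c, d⟩ ⟨⟨a', b'⟩, c', d'⟩ h; simp_all) (outer w z))
    (pull (fun s : (γ × δ) × (α × β) => ((s.2.1, s.1.2), (s.2.2, s.1.1)))
      (by rintro ⟨⟨a, b⟩, c, d⟩ ⟨⟨a', b'⟩, c', d'⟩ h; simp_all) (outer x y))
  refine h.congr fun s => ?_
  change (w (s.2.1, s.1.1) * z (s.2.2, s.1.2)) * (x (s.2.1, s.1.2) * y (s.2.2, s.1.1)) = _
  ring

/-- The cyclic contraction of four tables, carried out in stages. -/
theorem tsum_cyclic {δ : Type} (w : HS (α × γ)) (x : HS (α × δ)) (y : HS (β × γ))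
    (z : HS (β × δ)) :
    ∑' s : (γ × δ) × (α × β),
      (w (s.2.1, s.1.1) * x (s.2.1, s.1.2)) * (y (s.2.2, s.1.1) * z (s.2.2, s.1.2)) =
    ∑' q : γ × δ, (∑' a, w (a, q.1) * x (a, q.2)) * (∑' b, y (b, q.1) * z (b, q.2)) := by
  rw [(summable_cyclic w x y z).tsum_prod]
  refine tsum_congr fun q => ?_
  have h₁ := summable_mul (pull (fun a => (a, q.1)) (Prod.mk_left_injective q.1) w)
    (pull (fun a => (a, q.2)) (Prod.mk_left_injective q.2) x)
  have h₂ := summable_mul (pull (fun a => (a, q.1)) (Prod.mk_left_injective q.1) y)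
    (pull (fun a => (a, q.2)) (Prod.mk_left_injective q.2) z)
  exact (tsum_mul_tsum_of_summable_norm h₁.norm h₂.norm).symm

/-- The cyclic contraction of four tables may be carried out in either order. -/
theorem tsum_cyclic_comm {δ : Type} (w : HS (α × γ)) (x : HS (α × δ)) (y : HS (β × γ))
    (z : HS (β × δ)) :
    ∑' q : γ × δ, (∑' a, w (a, q.1) * x (a, q.2)) * (∑' b, y (b, q.1) * z (b, q.2)) =
    ∑' p : α × β, (∑' c, w (p.1, c) * y (p.2, c)) * (∑' d, x (p.1, d) * z (p.2, d)) := by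
  have h := tsum_cyclic (pull Prod.swap Prod.swap_injective w) (pull Prod.swap Prod.swap_injective y)
    (pull Prod.swap Prod.swap_injective x) (pull Prod.swap Prod.swap_injective z)
  refine ((tsum_cyclic w x y z).symm.trans ?_).trans h
  rw [← (Equiv.prodComm (α × β) (γ × δ)).tsum_eq]
  refine tsum_congr fun s => ?_
  change (w (s.1.1, s.2.1) * x (s.1.1, s.2.2)) * (y (s.1.2, s.2.1) * z (s.1.2, s.2.2)) =
    (w (s.1.1, s.2.1) * y (s.1.2, s.2.1)) * (x (s.1.1, s.2.2) * z (s.1.2, s.2.2))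
  ring

end HS

/-! ### Four-leg tables: rows, stacks, conjugation, and agreement with the coordinate definitions.
-/

namespace HS

open Function

variable {α α' β β' β₁ β₂ γ ι ι' κ κ' ρ ρ' ρ₁ ρ₂ : Type}

/-- Mirror image of a four-leg table: the right and the left leg are exchanged. -/
def mirror : HS (ι × β × κ × ρ) →ₗ[ℝ] HS (κ × β × ι × ρ) :=
  pull (fun p => (p.2.2.1, p.2.1, p.1, p.2.2.2))
    (fun p q h => by simp only [Prod.ext_iff] at h ⊢; tauto)

theorem mirror_apply (x : HS (ι × β × κ × ρ)) (i : ι) (j : β) (k : κ) (l : ρ) :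
    mirror x (k, j, i, l) = x (i, j, k, l) := rfl

theorem norm_mirror_le (x : HS (ι × β × κ × ρ)) : ‖mirror x‖ ≤ ‖x‖ := norm_pull_le _ _ _

/-- Transposition of a four-leg table: horizontal and vertical legs are exchanged. -/
def transp : HS (ι × β × κ × ρ) →ₗ[ℝ] HS (β × ι × ρ × κ) :=
  pull (fun p => (p.2.1, p.1, p.2.2.2, p.2.2.1))
    (fun p q h => by simp only [Prod.ext_iff] at h ⊢; tauto)

theorem transp_apply (x : HS (ι × β × κ × ρ)) (i : ι) (j : β) (k : κ) (l : ρ) :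
    transp x (j, i, l, k) = x (i, j, k, l) := rfl

theorem norm_transp_le (x : HS (ι × β × κ × ρ)) : ‖transp x‖ ≤ ‖x‖ := norm_pull_le _ _ _

/-- Horizontal composition of two four-leg tables, the first one on the left. -/
def row : HS (γ × β₁ × κ × ρ₁) →ₗ[ℝ] HS (ι × β₂ × γ × ρ₂) →ₗ[ℝ]
    HS (ι × (β₁ × β₂) × κ × (ρ₁ × ρ₂)) :=
  LinearMap.compr₂ (LinearMap.compl₁₂ mul
    (pull (fun p : (β₁ × κ × ρ₁) × γ => (p.2, p.1.1, p.1.2.1, p.1.2.2))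
      (fun p q h => by simp only [Prod.ext_iff] at h ⊢; tauto))
    (pull (fun p : γ × (ι × β₂ × ρ₂) => (p.2.1, p.2.2.1, p.1, p.2.2.2))
      (fun p q h => by simp only [Prod.ext_iff] at h ⊢; tauto)))
    (pull (fun p : ι × (β₁ × β₂) × κ × (ρ₁ × ρ₂) =>
        ((p.2.1.1, p.2.2.1, p.2.2.2.1), (p.1, p.2.1.2, p.2.2.2.2)))
      (fun p q h => by simp only [Prod.ext_iff] at h ⊢; tauto))

theorem row_apply (x : HS (γ × β₁ × κ × ρ₁)) (y : HS (ι × β₂ × γ × ρ₂)) (i : ι) (j : β₁ × β₂)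
    (k : κ) (l : ρ₁ × ρ₂) :
    row x y (i, j, k, l) = ∑' a, x (a, j.1, k, l.1) * y (i, j.2, a, l.2) := rfl

theorem norm_row_le (x : HS (γ × β₁ × κ × ρ₁)) (y : HS (ι × β₂ × γ × ρ₂)) :
    ‖row x y‖ ≤ ‖x‖ * ‖y‖ :=
  (norm_pull_le _ (fun p q h => by simp only [Prod.ext_iff] at h ⊢; tauto) _).trans ((norm_mul_le _ _).trans
    (mul_le_mul (norm_pull_le _ _ _) (norm_pull_le _ _ _) (norm_nonneg _) (norm_nonneg _)))

/-- Vertical composition of two four-leg tables, the first one on top. -/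
def vst : HS (ι × β × κ × γ) →ₗ[ℝ] HS (ι' × γ × κ' × ρ) →ₗ[ℝ]
    HS ((ι × ι') × β × (κ × κ') × ρ) :=
  LinearMap.compr₂ (LinearMap.compl₁₂ mul
    (pull (fun p : (ι × β × κ) × γ => (p.1.1, p.1.2.1, p.1.2.2, p.2))
      (fun p q h => by simp only [Prod.ext_iff] at h ⊢; tauto))
    (pull (fun p : γ × (ι' × κ' × ρ) => (p.2.1, p.1, p.2.2.1, p.2.2.2))
      (fun p q h => by simp only [Prod.ext_iff] at h ⊢; tauto)))
    (pull (fun p : (ι × ι') × β × (κ × κ') × ρ =>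
        ((p.1.1, p.2.1, p.2.2.1.1), (p.1.2, p.2.2.1.2, p.2.2.2)))
      (fun p q h => by simp only [Prod.ext_iff] at h ⊢; tauto))

theorem vst_apply (x : HS (ι × β × κ × γ)) (y : HS (ι' × γ × κ' × ρ)) (i : ι × ι') (j : β)
    (k : κ × κ') (l : ρ) :
    vst x y (i, j, k, l) = ∑' c, x (i.1, j, k.1, c) * y (i.2, c, k.2, l) := rfl

theorem norm_vst_le (x : HS (ι × β × κ × γ)) (y : HS (ι' × γ × κ' × ρ)) :
    ‖vst x y‖ ≤ ‖x‖ * ‖y‖ :=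
  (norm_pull_le _ (fun p q h => by simp only [Prod.ext_iff] at h ⊢; tauto) _).trans ((norm_mul_le _ _).trans
    (mul_le_mul (norm_pull_le _ _ _) (norm_pull_le _ _ _) (norm_nonneg _) (norm_nonneg _)))

theorem row_basisVec_right [DecidableEq ι] [DecidableEq β₂] [DecidableEq γ] [DecidableEq ρ₂]
    (x : HS (γ × β₁ × κ × ρ₁)) (i₀ : ι) (j₀ : β₂) (c : γ) (l₀ : ρ₂)
    (i : ι) (j : β₁ × β₂) (k : κ) (l : ρ₁ × ρ₂) :
    row x (basisVec (i₀, j₀, c, l₀)) (i, j, k, l) =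
      if i = i₀ ∧ j.2 = j₀ ∧ l.2 = l₀ then x (c, j.1, k, l.1) else 0 := by
  rw [row_apply, tsum_eq_single c]
  · simp only [basisVec_apply, Prod.mk.injEq]
    split_ifs <;> simp_all
  · intro b hb
    simp [basisVec_apply, hb]

theorem row_basisVec_left [DecidableEq β₁] [DecidableEq κ] [DecidableEq γ] [DecidableEq ρ₁]
    (y : HS (ι × β₂ × γ × ρ₂)) (c : γ) (j₀ : β₁) (k₀ : κ) (l₀ : ρ₁)
    (i : ι) (j : β₁ × β₂) (k : κ) (l : ρ₁ × ρ₂) :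
    row (basisVec (c, j₀, k₀, l₀)) y (i, j, k, l) =
      if k = k₀ ∧ j.1 = j₀ ∧ l.1 = l₀ then y (i, j.2, c, l.2) else 0 := by
  rw [row_apply, tsum_eq_single c]
  · simp only [basisVec_apply, Prod.mk.injEq]
    split_ifs <;> simp_all
  · intro b hb
    simp [basisVec_apply, hb]

theorem row_basisVec [DecidableEq ι] [DecidableEq β₁] [DecidableEq β₂] [DecidableEq κ] [DecidableEq γ] [DecidableEq ρ₁] [DecidableEq ρ₂]
    (i : ι) (j₁ : β₁) (j₂ : β₂) (k : κ) (c : γ) (l₁ : ρ₁) (l₂ : ρ₂) :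
    row (basisVec (c, j₁, k, l₁)) (basisVec (i, j₂, c, l₂)) =
      basisVec (i, (j₁, j₂), k, (l₁, l₂)) := by
  ext ⟨i', ⟨j₁', j₂'⟩, k', ⟨l₁', l₂'⟩⟩
  rw [row_basisVec_right]
  simp only [basisVec_apply, Prod.mk.injEq]
  split_ifs <;> simp_all

theorem vst_basisVec_right [DecidableEq ι'] [DecidableEq γ] [DecidableEq κ'] [DecidableEq ρ]
    (x : HS (ι × β × κ × γ)) (i₀ : ι') (c : γ) (k₀ : κ') (l₀ : ρ)
    (i : ι × ι') (j : β) (k : κ × κ') (l : ρ) :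
    vst x (basisVec (i₀, c, k₀, l₀)) (i, j, k, l) =
      if i.2 = i₀ ∧ k.2 = k₀ ∧ l = l₀ then x (i.1, j, k.1, c) else 0 := by
  rw [vst_apply, tsum_eq_single c]
  · simp only [basisVec_apply, Prod.mk.injEq]
    split_ifs <;> simp_all
  · intro b hb
    simp [basisVec_apply, hb]

theorem vst_basisVec_left [DecidableEq ι] [DecidableEq β] [DecidableEq κ] [DecidableEq γ]
    (y : HS (ι' × γ × κ' × ρ)) (i₀ : ι) (c : γ) (k₀ : κ) (j₀ : β)
    (i : ι × ι') (j : β) (k : κ × κ') (l : ρ) :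
    vst (basisVec (i₀, j₀, k₀, c)) y (i, j, k, l) =
      if i.1 = i₀ ∧ k.1 = k₀ ∧ j = j₀ then y (i.2, c, k.2, l) else 0 := by
  rw [vst_apply, tsum_eq_single c]
  · simp only [basisVec_apply, Prod.mk.injEq]
    split_ifs <;> simp_all
  · intro b hb
    simp [basisVec_apply, hb]

theorem vst_basisVec [DecidableEq ι] [DecidableEq ι'] [DecidableEq β] [DecidableEq κ] [DecidableEq κ'] [DecidableEq γ] [DecidableEq ρ]
    (i : ι) (i' : ι') (j : β) (k : κ) (k' : κ') (c : γ) (l : ρ) :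
    vst (basisVec (i, j, k, c)) (basisVec (i', c, k', l)) =
      basisVec ((i, i'), j, (k, k'), l) := by
  ext ⟨⟨i₁, i₂⟩, j', ⟨k₁, k₂⟩, l'⟩
  rw [vst_basisVec_right]
  simp only [basisVec_apply, Prod.mk.injEq]
  split_ifs <;> simp_all

theorem vst_eq_zero (x : HS (ι × β × κ × γ)) (y : HS (ι' × γ × κ' × ρ))
    (h : ∀ i j k c i' k' l, x (i, j, k, c) = 0 ∨ y (i', c, k', l) = 0) : vst x y = 0 := by
  ext ⟨i, j, k, l⟩
  rw [vst_apply]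
  refine (tsum_congr fun c => ?_).trans tsum_zero
  rcases h i.1 j k.1 c i.2 k.2 l with h | h <;> simp [h]

/-- A bounded operator acting on the left leg of a four-leg table. -/
def lact (F : HS κ →L[ℝ] HS κ') : HS (ι × β × κ × ρ) →ₗ[ℝ] HS (ι × β × κ' × ρ) :=
  (pull (fun p : ι × β × κ' × ρ => (p.2.2.1, (p.1, p.2.1, p.2.2.2)))
      (fun p q h => by simp only [Prod.ext_iff] at h ⊢; tauto)) ∘ₗ legAct F ∘ₗ
    (pull (fun p : κ × (ι × β × ρ) => (p.2.1, p.2.2.1, p.1, p.2.2.2))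
      (fun p q h => by simp only [Prod.ext_iff] at h ⊢; tauto))

/-- The left leg of a four-leg table, the other three indices being fixed. -/
def leftFibre (x : HS (ι × β × κ × ρ)) (i : ι) (j : β) (l : ρ) : HS κ :=
  pull (fun k => (i, j, k, l)) (fun p q h => by simp only [Prod.ext_iff] at h ⊢; tauto) x

theorem leftFibre_apply (x : HS (ι × β × κ × ρ)) (i : ι) (j : β) (l : ρ) (k : κ) :
    leftFibre x i j l k = x (i, j, k, l) := rfl

theorem lact_apply (F : HS κ →L[ℝ] HS κ') (x : HS (ι × β × κ × ρ)) (i : ι) (j : β) (k : κ')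
    (l : ρ) : lact F x (i, j, k, l) = F (leftFibre x i j l) k := rfl

theorem norm_lact_le (F : HS κ →L[ℝ] HS κ') (x : HS (ι × β × κ × ρ)) :
    ‖lact F x‖ ≤ ‖F‖ * ‖x‖ :=
  (norm_pull_le _ (fun p q h => by simp only [Prod.ext_iff] at h ⊢; tauto) _).trans ((norm_legAct_le _ _).trans
    (mul_le_mul_of_nonneg_left (norm_pull_le _ _ _) (norm_nonneg _)))

/-- The transpose of a bounded operator acting on the right leg of a four-leg table. -/
def ract (F : HS ι' →L[ℝ] HS ι) : HS (ι × β × κ × ρ) →ₗ[ℝ] HS (ι' × β × κ × ρ) :=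
  mirror ∘ₗ lact (ContinuousLinearMap.adjoint F) ∘ₗ mirror

theorem ract_eq (F : HS ι' →L[ℝ] HS ι) (x : HS (ι × β × κ × ρ)) :
    ract F x = mirror (lact (ContinuousLinearMap.adjoint F) (mirror x)) := rfl

theorem norm_ract_le (F : HS ι' →L[ℝ] HS ι) (x : HS (ι × β × κ × ρ)) :
    ‖ract F x‖ ≤ ‖F‖ * ‖x‖ := by
  refine (norm_mirror_le _).trans ((norm_lact_le _ _).trans ?_)
  rw [LinearIsometryEquiv.norm_map]
  exact mul_le_mul_of_nonneg_left (norm_mirror_le _) (norm_nonneg _)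

@[simp] theorem lact_id (x : HS (ι × β × κ × ρ)) :
    lact (ContinuousLinearMap.id ℝ (HS κ)) x = x := rfl

theorem lact_add (F G : HS κ →L[ℝ] HS κ') (x : HS (ι × β × κ × ρ)) :
    lact (F + G) x = lact F x + lact G x := rfl

theorem lact_sub (F G : HS κ →L[ℝ] HS κ') (x : HS (ι × β × κ × ρ)) :
    lact (F - G) x = lact F x - lact G x := rfl

theorem lact_comp {κ'' : Type} (F : HS κ' →L[ℝ] HS κ'') (G : HS κ →L[ℝ] HS κ')
    (x : HS (ι × β × κ × ρ)) : lact (F ∘L G) x = lact F (lact G x) := rfl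

@[simp] theorem ract_id (x : HS (ι × β × κ × ρ)) :
    ract (ContinuousLinearMap.id ℝ (HS ι)) x = x := by
  rw [ract_eq, ← ContinuousLinearMap.one_def, ← ContinuousLinearMap.star_eq_adjoint, star_one]
  rfl

theorem ract_add (F G : HS ι' →L[ℝ] HS ι) (x : HS (ι × β × κ × ρ)) :
    ract (F + G) x = ract F x + ract G x := by
  rw [ract_eq, map_add, lact_add, map_add]
  rfl

theorem ract_sub (F G : HS ι' →L[ℝ] HS ι) (x : HS (ι × β × κ × ρ)) :
    ract (F - G) x = ract F x - ract G x := by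
  rw [ract_eq, map_sub, lact_sub, map_sub]
  rfl

theorem ract_comp {ι'' : Type} (F : HS ι' →L[ℝ] HS ι) (G : HS ι'' →L[ℝ] HS ι')
    (x : HS (ι × β × κ × ρ)) : ract (F ∘L G) x = ract G (ract F x) := by
  rw [ract_eq, ContinuousLinearMap.adjoint_comp]
  rfl

theorem adjoint_basisVec_apply [DecidableEq ι] [DecidableEq κ] (F : HS ι →L[ℝ] HS κ) (k : κ)
    (i : ι) : ContinuousLinearMap.adjoint F (basisVec k) i = entry F k i := by
  rw [← inner_basisVec_left, ContinuousLinearMap.adjoint_inner_right, real_inner_comm,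
    inner_basisVec_left]
  rfl

theorem apply_eq_tsum_entry [DecidableEq ι] [DecidableEq κ] (F : HS ι →L[ℝ] HS κ) (x : HS ι)
    (k : κ) : F x k = ∑' i, entry F k i * x i := by
  rw [← inner_basisVec_left, ← ContinuousLinearMap.adjoint_inner_left, inner_eq]
  simp only [adjoint_basisVec_apply]

theorem adjoint_apply_eq_tsum_entry [DecidableEq ι] [DecidableEq κ] (F : HS ι →L[ℝ] HS κ)
    (y : HS κ) (i : ι) : ContinuousLinearMap.adjoint F y i = ∑' k, entry F k i * y k := by
  rw [← inner_basisVec_left, ContinuousLinearMap.adjoint_inner_right, inner_eq]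
  rfl

/-- Conjugation of the horizontal legs, as an operator on Hilbert–Schmidt tables. -/
def conjHL (F : HS α' ≃L[ℝ] HS α) (x : HS (α × β × α × ρ)) : HS (α' × β × α' × ρ) :=
  lact (F.symm : HS α →L[ℝ] HS α') (ract (F : HS α' →L[ℝ] HS α) x)

/-- A row of $F^{-1}$ and a column of $F$ are both in $\ell^2$, so the double sum pairs their tensor
product with a slice of the table and converges absolutely; it may then be carried out one leg at a
time. -/
theorem conjH_coe [DecidableEq α] [DecidableEq α'] (F : HS α' ≃L[ℝ] HS α)
    (x : HS (α × β × α × β)) : conjH F x = conjHL F x := by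
  funext ⟨i, j, k, l⟩
  change ∑' p : α × α, entry (F.symm : HS α →L[ℝ] HS α') k p.1 * x (p.2, j, p.1, l) *
      entry (F : HS α' →L[ℝ] HS α) p.2 i = _
  rw [conjHL, lact_apply, apply_eq_tsum_entry, Summable.tsum_prod]
  · refine tsum_congr fun p => ?_
    rw [leftFibre_apply]
    change _ = _ * ContinuousLinearMap.adjoint (F : HS α' →L[ℝ] HS α)
      (leftFibre (mirror x) p j l) i
    rw [adjoint_apply_eq_tsum_entry, ← tsum_mul_left]
    refine tsum_congr fun q => ?_
    change _ = _ * (_ * x (q, j, p, l))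
    ring
  · have h := summable_mul
      (outer (ContinuousLinearMap.adjoint (F.symm : HS α →L[ℝ] HS α') (basisVec k))
        ((F : HS α' →L[ℝ] HS α) (basisVec i)))
      (pull (fun p : α × α => (p.2, j, p.1, l))
        (fun p q h => by simp only [Prod.ext_iff] at h ⊢; tauto) x)
    refine h.congr fun p => ?_
    rw [outer_apply, adjoint_basisVec_apply]
    change entry (F.symm : HS α →L[ℝ] HS α') k p.1 * (F : HS α' →L[ℝ] HS α) (basisVec i) p.2 *
      x (p.2, j, p.1, l) = entry (F.symm : HS α →L[ℝ] HS α') k p.1 * x (p.2, j, p.1, l) *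
      (F : HS α' →L[ℝ] HS α) (basisVec i) p.2
    ring

/-- Conjugation of the vertical legs, as an operator on Hilbert–Schmidt tables. -/
def conjVL (F : HS β' ≃L[ℝ] HS β) (x : HS (α × β × κ × β)) : HS (α × β' × κ × β') :=
  transp (conjHL F (transp x))

theorem conjV_coe [DecidableEq β] [DecidableEq β'] (F : HS β' ≃L[ℝ] HS β)
    (x : HS (α × β × α × β)) : conjV F x = conjVL F x := by
  funext ⟨i, j, k, l⟩
  exact congrFun (conjH_coe F (transp x)) (j, i, l, k)

/-- The four inner bonds form a cycle, so `tsum_cyclic` turns the joint sum into rows followed by a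
stack. -/
theorem block_coe (x : Tensor4) : block x = vst (row x x) (row x x) := by
  funext ⟨⟨i₁, i₂⟩, ⟨j₁, j₂⟩, ⟨k₁, k₂⟩, ⟨l₁, l₂⟩⟩
  have h := tsum_cyclic
    (pull (fun p : ℕ × ℕ => (p.1, j₁, k₁, p.2))
      (fun p q h => by simp only [Prod.ext_iff] at h ⊢; tauto) x)
    (pull (fun p : ℕ × ℕ => (i₁, j₂, p.1, p.2))
      (fun p q h => by simp only [Prod.ext_iff] at h ⊢; tauto) x)
    (pull (fun p : ℕ × ℕ => (p.1, p.2, k₂, l₁))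
      (fun p q h => by simp only [Prod.ext_iff] at h ⊢; tauto) x)
    (pull (fun p : ℕ × ℕ => (i₂, p.2, p.1, l₂))
      (fun p q h => by simp only [Prod.ext_iff] at h ⊢; tauto) x)
  refine Eq.trans ?_ h
  rw [← (⟨fun s => ((s.2.2.1, s.2.2.2), (s.1, s.2.1)), fun s => (s.2.1, s.2.2, s.1.1, s.1.2),
    fun _ => rfl, fun _ => rfl⟩ : ℕ × ℕ × ℕ × ℕ ≃ (ℕ × ℕ) × (ℕ × ℕ)).tsum_eq]
  refine tsum_congr fun ⟨a, b, c, d⟩ => ?_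
  exact mul_assoc _ _ _

theorem stackDU_coe (y : LowerHalf) (x : UpperHalf) : stackDU y x = vst y x := rfl

end HS

/-! ### Rank-one shears and their second-order remainder. -/

namespace HS

open Function InnerProductSpace

variable {α β γ δ ι ι' κ κ' ρ : Type}

/-- The operator `|m⟩⟨o|` acting on the left leg. -/
def ket [DecidableEq κ] (o : κ) (m : HS κ) : HS (ι × β × κ × ρ) →ₗ[ℝ] HS (ι × β × κ × ρ) :=
  lact (rankOne ℝ m (basisVec o))

/-- The operator `|o⟩⟨m|` acting on the left leg. -/
def bra [DecidableEq κ] (o : κ) (m : HS κ) : HS (ι × β × κ × ρ) →ₗ[ℝ] HS (ι × β × κ × ρ) :=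
  lact (rankOne ℝ (basisVec o) m)

theorem ket_apply [DecidableEq κ] (o : κ) (m : HS κ) (x : HS (ι × β × κ × ρ)) (i : ι) (j : β)
    (k : κ) (l : ρ) : ket o m x (i, j, k, l) = x (i, j, o, l) * m k := by
  rw [ket, lact_apply, rankOne_apply, inner_basisVec_left]
  rfl

theorem bra_apply [DecidableEq κ] (o : κ) (m : HS κ) (x : HS (ι × β × κ × ρ)) (i : ι) (j : β)
    (k : κ) (l : ρ) :
    bra o m x (i, j, k, l) = if k = o then ∑' k', m k' * x (i, j, k', l) else 0 := by
  rw [bra, lact_apply, rankOne_apply, inner_eq]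
  change _ * (basisVec o : HS κ) k = _
  rw [basisVec_apply, mul_ite, mul_one, mul_zero]
  rfl

theorem norm_ket_le [DecidableEq κ] (o : κ) (m : HS κ) (x : HS (ι × β × κ × ρ)) :
    ‖ket o m x‖ ≤ ‖m‖ * ‖x‖ := by
  refine (norm_lact_le _ _).trans_eq ?_
  simp

theorem norm_bra_le [DecidableEq κ] (o : κ) (m : HS κ) (x : HS (ι × β × κ × ρ)) :
    ‖bra o m x‖ ≤ ‖m‖ * ‖x‖ := by
  refine (norm_lact_le _ _).trans_eq ?_
  simp

theorem ket_sub_smul [DecidableEq κ] (o : κ) (m m' : HS κ) (c : ℝ) (x : HS (ι × β × κ × ρ)) :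
    ket o (m - c • m') x = ket o m x - c • ket o m' x := by
  ext ⟨i, j, k, l⟩
  simp only [ket_apply, sub_apply, smul_apply]
  ring

theorem bra_sub_smul [DecidableEq κ] (o : κ) (m m' : HS κ) (c : ℝ) (x : HS (ι × β × κ × ρ)) :
    bra o (m - c • m') x = bra o m x - c • bra o m' x := by
  ext ⟨i, j, k, l⟩
  simp only [bra, lact_apply, rankOne_apply, inner_sub_left, sub_apply, smul_apply,
    inner_smul_left, RCLike.conj_to_real]
  ring

theorem bra_basisVec [DecidableEq ι] [DecidableEq β] [DecidableEq κ] [DecidableEq ρ] (o : κ)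
    (m : HS κ) (hm : m o = 0) (i : ι) (j : β) (l : ρ) :
    bra o m (basisVec (i, j, o, l)) = 0 := by
  ext ⟨i', j', k', l'⟩
  rw [bra_apply, tsum_eq_single o]
  · simp [hm]
  · intro k hk
    simp [basisVec_apply, hk]

/-- The operator `(1 + |m⟩⟨o|) (1 - |o⟩⟨m'|)`, where `m` and `m'` are orthogonal to `o`. -/
def shear [DecidableEq α] (o : α) (m m' : HS α) (hm : m o = 0) (hm' : m' o = 0) :
    HS α ≃L[ℝ] HS α :=
  ContinuousLinearEquiv.equivOfInverse
    ((ContinuousLinearMap.id ℝ (HS α) + rankOne ℝ m (basisVec o)) ∘L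
      (ContinuousLinearMap.id ℝ (HS α) - rankOne ℝ (basisVec o) m'))
    ((ContinuousLinearMap.id ℝ (HS α) + rankOne ℝ (basisVec o) m') ∘L
      (ContinuousLinearMap.id ℝ (HS α) - rankOne ℝ m (basisVec o)))
    -- Orthogonality of `m` and `m'` to `o` makes both rank-one operators square to zero, so each
    -- factor is inverted by a change of sign.
    (fun x => by
      have h₁ : inner ℝ (basisVec o) m = (0 : ℝ) := by rw [inner_basisVec_left, hm]
      have h₂ : inner ℝ m' (basisVec o) = (0 : ℝ) := by
        rw [real_inner_comm, inner_basisVec_left, hm']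
      simp [rankOne_apply, inner_add_right, inner_sub_right, inner_smul_right, h₁, h₂]
      module)
    (fun x => by
      have h₁ : inner ℝ (basisVec o) m = (0 : ℝ) := by rw [inner_basisVec_left, hm]
      have h₂ : inner ℝ m' (basisVec o) = (0 : ℝ) := by
        rw [real_inner_comm, inner_basisVec_left, hm']
      simp [rankOne_apply, inner_add_right, inner_sub_right, inner_smul_right, h₁, h₂]
      module)

/-- `bra` acting on the right leg. -/
def rbra [DecidableEq ι] (o : ι) (m : HS ι) : HS (ι × β × κ × ρ) →ₗ[ℝ] HS (ι × β × κ × ρ) :=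
  mirror ∘ₗ bra o m ∘ₗ mirror

/-- `ket` acting on the right leg. -/
def rket [DecidableEq ι] (o : ι) (m : HS ι) : HS (ι × β × κ × ρ) →ₗ[ℝ] HS (ι × β × κ × ρ) :=
  mirror ∘ₗ ket o m ∘ₗ mirror

/-- The product `(1 + L₂) (1 - L₁) (1 - P₂) (1 + P₁)`. -/
def shearProd {W : Type} [AddCommGroup W] [Module ℝ W] (L₁ L₂ P₁ P₂ : W →ₗ[ℝ] W) : W →ₗ[ℝ] W :=
  (LinearMap.id + L₂) ∘ₗ (LinearMap.id - L₁) ∘ₗ (LinearMap.id - P₂) ∘ₗ (LinearMap.id + P₁)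

/-- The right leg sees the adjoint of the shear, which exchanges kets and bras and reverses the
order of the factors. -/
theorem conjHL_shear [DecidableEq α] (o : α) (m m' : HS α) (hm : m o = 0) (hm' : m' o = 0)
    (x : HS (α × β × α × ρ)) :
    conjHL (shear o m m' hm hm') x =
      shearProd (ket o m) (bra o m') (rbra o m) (rket o m') x := by
  have h : conjHL (shear o m m' hm hm') x =
    lact ((ContinuousLinearMap.id ℝ (HS α) + rankOne ℝ (basisVec o) m') ∘L
      (ContinuousLinearMap.id ℝ (HS α) - rankOne ℝ m (basisVec o)))
      (ract ((ContinuousLinearMap.id ℝ (HS α) + rankOne ℝ m (basisVec o)) ∘L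
      (ContinuousLinearMap.id ℝ (HS α) - rankOne ℝ (basisVec o) m')) x) := rfl
  rw [h, lact_comp, ract_comp, ract_add, ract_sub, lact_sub, lact_add]
  simp only [ract_id, lact_id]
  simp only [ract_eq, adjoint_rankOne]
  rfl

/-- With $P_1e=L_2e=0$, the first-order action on $e$ is only $-L_1e-P_2e$; every other term
contains either $d$ with at least one operator or $e$ with at least two. Applying the factors in
turn, the terms in $d$ cost $1+2+4+8=15$ times $cs$ and those in $e$ cost $c^2+(2c^2+c^3)\le 4c^2$.
The size `Sz` is left abstract so that the bound applies to the norm and to `Factors`. -/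
theorem shearProd_estimate {W : Type} [AddCommGroup W] [Module ℝ W] {Sz : ℝ → W → Prop}
    (hmono : ∀ {r s x}, r ≤ s → Sz r x → Sz s x)
    (hadd : ∀ {r s x y}, Sz r x → Sz s y → Sz (r + s) (x + y))
    (hneg : ∀ {r x}, Sz r x → Sz r (-x))
    {L₁ L₂ P₁ P₂ : W →ₗ[ℝ] W} {c s : ℝ} (hc : 0 ≤ c) (hc1 : c ≤ 1) (hs : 0 ≤ s)
    (hL₁ : ∀ {r x}, Sz r x → Sz (c * r) (L₁ x)) (hL₂ : ∀ {r x}, Sz r x → Sz (c * r) (L₂ x))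
    (hP₁ : ∀ {r x}, Sz r x → Sz (c * r) (P₁ x)) (hP₂ : ∀ {r x}, Sz r x → Sz (c * r) (P₂ x))
    {e d : W} (he : Sz 1 e) (hd : Sz s d) (hPe : P₁ e = 0) (hLe : L₂ e = 0) :
    Sz (15 * c * s + 4 * c ^ 2)
      (shearProd L₁ L₂ P₁ P₂ (e + d) - (e + d - L₁ e - P₂ e)) := by
  have hsub : ∀ {r s x y}, Sz r x → Sz s y → Sz (r + s) (x - y) := fun hx hy => by
    rw [sub_eq_add_neg]; exact hadd hx (hneg hy)
  have hcs : c * s ≤ s := by nlinarith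
  have ha := hP₁ hd
  have h₁ : Sz (2 * s) (d + P₁ d) := hmono (by linarith) (hadd hd ha)
  have hb := hP₂ h₁
  have h₂ : Sz (4 * s) (d + P₁ d - P₂ (d + P₁ d)) := hmono (by linarith) (hsub h₁ hb)
  have hc' := hL₁ h₂
  have h₃ := hL₂ (hmono (s := 8 * s) (by linarith) (hsub h₂ hc'))
  have hp := hP₂ he
  have hl := hL₁ he
  have hlp := hL₁ hp
  have h₄ := hL₂ (hsub (hsub hlp hp) hl)
  have h := hmono (s := 15 * c * s + 4 * c ^ 2)
    (by nlinarith [mul_nonneg hc (mul_nonneg hc (sub_nonneg.2 hc1))])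
    (hadd (hadd (hsub (hsub ha hb) hc') h₃) (hadd hlp h₄))
  convert h using 1
  simp only [shearProd, LinearMap.comp_apply, LinearMap.add_apply, LinearMap.sub_apply,
      LinearMap.id_apply, map_add, map_sub, hPe,
      hLe, map_zero]
  abel

end HS

/-! ### Blocks that split into Hilbert–Schmidt halves, and the calculus of their size. -/

namespace HS

open Function

variable {α β γ δ ι ι' κ κ' ρ : Type}

/-- Relabelling of the bottom leg along an injective map. -/
def pushBottom (f : γ → δ) (hf : Injective f) :
    HS (ι × β × κ × γ) →ₗ[ℝ] HS (ι × β × κ × δ) :=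
  push (fun p => (p.1, p.2.1, p.2.2.1, f p.2.2.2))
    (fun p q h => by simp only [Prod.ext_iff, hf.eq_iff] at h ⊢; tauto)

/-- Relabelling of the top leg along an injective map. -/
def pushTop (f : γ → δ) (hf : Injective f) :
    HS (ι × γ × κ × ρ) →ₗ[ℝ] HS (ι × δ × κ × ρ) :=
  push (fun p => (p.1, f p.2.1, p.2.2.1, p.2.2.2))
    (fun p q h => by simp only [Prod.ext_iff, hf.eq_iff] at h ⊢; tauto)

theorem pushBottom_apply (f : γ → δ) (hf : Injective f) (x : HS (ι × β × κ × γ)) (i : ι) (j : β)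
    (k : κ) (c : γ) : pushBottom f hf x (i, j, k, f c) = x (i, j, k, c) :=
  push_apply _ (fun p q h => by simp only [Prod.ext_iff, hf.eq_iff] at h ⊢; tauto) x (i, j, k, c)

theorem pushTop_apply (f : γ → δ) (hf : Injective f) (x : HS (ι × γ × κ × ρ)) (i : ι) (k : κ)
    (l : ρ) (c : γ) : pushTop f hf x (i, f c, k, l) = x (i, c, k, l) :=
  push_apply _ (fun p q h => by simp only [Prod.ext_iff, hf.eq_iff] at h ⊢; tauto) x (i, c, k, l)

theorem pushBottom_apply_of_notMem (f : γ → δ) (hf : Injective f) (x : HS (ι × β × κ × γ)) (i : ι)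
    (j : β) (k : κ) (d : δ) (h : d ∉ Set.range f) : pushBottom f hf x (i, j, k, d) = 0 := by
  refine push_apply_of_notMem _ _ _ _ ?_
  rintro ⟨p, hp⟩
  simp only [Prod.ext_iff] at hp
  exact h ⟨_, hp.2.2.2⟩

theorem pushTop_apply_of_notMem (f : γ → δ) (hf : Injective f) (x : HS (ι × γ × κ × ρ)) (i : ι)
    (k : κ) (l : ρ) (d : δ) (h : d ∉ Set.range f) : pushTop f hf x (i, d, k, l) = 0 := by
  refine push_apply_of_notMem _ _ _ _ ?_
  rintro ⟨p, hp⟩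
  simp only [Prod.ext_iff] at hp
  exact h ⟨_, hp.2.1⟩

theorem norm_pushBottom (f : γ → δ) (hf : Injective f) (x : HS (ι × β × κ × γ)) :
    ‖pushBottom f hf x‖ = ‖x‖ := norm_push _ _ _

theorem norm_pushTop (f : γ → δ) (hf : Injective f) (x : HS (ι × γ × κ × ρ)) :
    ‖pushTop f hf x‖ = ‖x‖ := norm_push _ _ _

theorem vst_push (f : γ → δ) (hf : Injective f) (x : HS (ι × β × κ × γ))
    (y : HS (ι' × γ × κ' × ρ)) : vst (pushBottom f hf x) (pushTop f hf y) = vst x y := by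
  ext ⟨i, j, k, l⟩
  rw [vst_apply, vst_apply, ← hf.tsum_eq]
  · simp only [pushBottom_apply, pushTop_apply]
  · intro d hd
    by_contra h
    exact hd (by simp [pushBottom_apply_of_notMem f hf _ _ _ _ d h])

theorem vst_push_of_disjoint {γ' : Type} (f : γ → δ) (hf : Injective f) (g : γ' → δ)
    (hg : Injective g) (h : ∀ a b, f a ≠ g b) (x : HS (ι × β × κ × γ))
    (y : HS (ι' × γ' × κ' × ρ)) : vst (pushBottom f hf x) (pushTop g hg y) = 0 := by
  refine vst_eq_zero _ _ fun i j k c i' k' l => ?_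
  by_cases hc : c ∈ Set.range f
  · obtain ⟨a, rfl⟩ := hc
    exact Or.inr (pushTop_apply_of_notMem g hg _ _ _ _ _ fun ⟨b, hb⟩ => h a b hb.symm)
  · exact Or.inl (pushBottom_apply_of_notMem f hf _ _ _ _ _ hc)

/-- Even and odd natural numbers host the bonds of a direct sum. -/
theorem injective_two_mul : Injective fun c : ℕ => 2 * c := fun a b h => by simp at h; omega

theorem injective_two_mul_add_one : Injective fun c : ℕ => 2 * c + 1 :=
  fun a b h => by simp at h; omega

/-- The two bonds become a direct sum inside one copy of $\mathbb{N}$; the cross terms vanish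
because even and odd labels never meet. -/
theorem vst_even_add_odd (f : γ → ℕ) (hf : Injective f) (x : HS (ι × β × κ × γ))
    (x' : HS (ι × β × κ × ℕ)) (y : HS (ι' × γ × κ' × ρ)) (y' : HS (ι' × ℕ × κ' × ρ)) :
    vst (pushBottom (fun c => 2 * f c) (injective_two_mul.comp hf) x +
        pushBottom (fun c => 2 * c + 1) injective_two_mul_add_one x')
      (pushTop (fun c => 2 * f c) (injective_two_mul.comp hf) y +
        pushTop (fun c => 2 * c + 1) injective_two_mul_add_one y') = vst x y + vst x' y' := by
  simp only [map_add, LinearMap.add_apply, vst_push]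
  rw [vst_push_of_disjoint _ _ _ _ (fun a b => by omega),
    vst_push_of_disjoint _ _ _ _ (fun a b => by omega)]
  abel

/-- `Factors r E`: the block `E` is the contraction of an upper and a lower half, both of
Hilbert–Schmidt norm at most `r`. -/
def Factors (r : ℝ) (E : HS ((ι × ι') × β × (κ × κ') × ρ)) : Prop :=
  ∃ (x : HS (ι × β × κ × ℕ)) (y : HS (ι' × ℕ × κ' × ρ)), E = vst x y ∧ ‖x‖ ≤ r ∧ ‖y‖ ≤ r

theorem Factors.mono {r s : ℝ} {E : HS ((ι × ι') × β × (κ × κ') × ρ)} (h : r ≤ s)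
    (hE : Factors r E) : Factors s E := by
  obtain ⟨x, y, rfl, hx, hy⟩ := hE
  exact ⟨x, y, rfl, hx.trans h, hy.trans h⟩

theorem Factors.neg {r : ℝ} {E : HS ((ι × ι') × β × (κ × κ') × ρ)} (hE : Factors r E) :
    Factors r (-E) := by
  obtain ⟨x, y, rfl, hx, hy⟩ := hE
  exact ⟨-x, y, by simp, by rwa [norm_neg], hy⟩

theorem Factors.add {r s : ℝ} {E E' : HS ((ι × ι') × β × (κ × κ') × ρ)} (hE : Factors r E)
    (hE' : Factors s E') : Factors (r + s) (E + E') := by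
  obtain ⟨x, y, rfl, hx, hy⟩ := hE
  obtain ⟨x', y', rfl, hx', hy'⟩ := hE'
  refine ⟨_, _, (vst_even_add_odd id injective_id x x' y y').symm, ?_, ?_⟩
  · refine (norm_add_le _ _).trans (add_le_add ?_ ?_)
    · rwa [norm_pushBottom]
    · rwa [norm_pushBottom]
  · refine (norm_add_le _ _).trans (add_le_add ?_ ?_)
    · rwa [norm_pushTop]
    · rwa [norm_pushTop]

theorem Factors.sub {r s : ℝ} {E E' : HS ((ι × ι') × β × (κ × κ') × ρ)} (hE : Factors r E)
    (hE' : Factors s E') : Factors (r + s) (E - E') := by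
  rw [sub_eq_add_neg]
  exact hE.add hE'.neg

theorem Factors.nonneg {r : ℝ} {E : HS ((ι × ι') × β × (κ × κ') × ρ)} (hE : Factors r E) :
    0 ≤ r := by
  obtain ⟨x, y, rfl, hx, hy⟩ := hE
  exact (norm_nonneg _).trans hx

/-- Only the product of the two norms matters: rescaling the halves by $t$ and $t^{-1}$ with
$t^2=\|y\|/\|x\|$ gives both the norm $\sqrt{\|x\|\|y\|}$. The injection `f` relabels an arbitrary
countable bond by natural numbers. -/
theorem Factors.of_vst (f : γ → ℕ) (hf : Injective f) (x : HS (ι × β × κ × γ))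
    (y : HS (ι' × γ × κ' × ρ)) {r : ℝ} (hr : 0 ≤ r) (h : ‖x‖ * ‖y‖ ≤ r ^ 2) :
    Factors r (vst x y) := by
  rcases eq_or_ne x 0 with rfl | hx
  · exact ⟨0, 0, by simp, by simpa, by simpa⟩
  rcases eq_or_ne y 0 with rfl | hy
  · exact ⟨0, 0, by simp, by simpa, by simpa⟩
  have hx' := norm_pos_iff.2 hx
  have hy' := norm_pos_iff.2 hy
  have ht : 0 < √(‖y‖ / ‖x‖) := Real.sqrt_pos.2 (by positivity)
  have ht2 : √(‖y‖ / ‖x‖) ^ 2 = ‖y‖ / ‖x‖ := Real.sq_sqrt (by positivity)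
  set t := √(‖y‖ / ‖x‖)
  refine ⟨t • pushBottom f hf x, t⁻¹ • pushTop f hf y, ?_, ?_, ?_⟩
  · rw [map_smul, map_smul, LinearMap.smul_apply, smul_smul, inv_mul_cancel₀ ht.ne', one_smul,
      vst_push]
  · rw [norm_smul, norm_pushBottom, Real.norm_of_nonneg ht.le]
    refine (sq_le_sq₀ (by positivity) hr).1 (le_trans (le_of_eq ?_) h)
    rw [mul_pow, ht2]
    field_simp
  · rw [norm_smul, norm_pushTop, norm_inv, Real.norm_of_nonneg ht.le]
    refine (sq_le_sq₀ (by positivity) hr).1 (le_trans (le_of_eq ?_) h)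
    rw [mul_pow, inv_pow, ht2]
    field_simp

/-- A scalar on the block is shared between the halves, so each of them pays only its square root.
-/
theorem Factors.smul {r : ℝ} {E : HS ((ι × ι') × β × (κ × κ') × ρ)} (hE : Factors r E) {a b : ℝ}
    (hb : 0 ≤ b) (hab : |a| ≤ b ^ 2) : Factors (b * r) (a • E) := by
  have hr := hE.nonneg
  obtain ⟨x, y, rfl, hx, hy⟩ := hE
  rw [← LinearMap.smul_apply, ← map_smul]
  refine Factors.of_vst id injective_id _ _ (by positivity) ?_
  rw [norm_smul, Real.norm_eq_abs, mul_pow, mul_assoc, sq r]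
  exact mul_le_mul hab (mul_le_mul hx hy (norm_nonneg _) hr) (by positivity) (by positivity)

theorem Factors.mirror {r : ℝ} {E : HS ((ι × ι') × β × (κ × κ') × ρ)} (hE : Factors r E) :
    Factors r (HS.mirror E) := by
  obtain ⟨x, y, rfl, hx, hy⟩ := hE
  exact ⟨HS.mirror x, HS.mirror y, rfl, (norm_mirror_le _).trans hx, (norm_mirror_le _).trans hy⟩

theorem injective_pair : Injective fun p : ℕ × ℕ => Nat.pair p.1 p.2 := Nat.pairEquiv.injective

/-- The new left vector is itself a product over an auxiliary bond: its upper half joins the upper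
half of the block and its lower half the lower one. The bond of the result is the pair of both
bonds, and the norms multiply half by half. -/
theorem Factors.ket {r c : ℝ} {E : HS ((ι × ι') × β × (κ × κ') × ρ)} [DecidableEq κ]
    [DecidableEq κ'] (hE : Factors r E) (o : κ × κ') (m₁ : HS (κ × ℕ)) (m₂ : HS (ℕ × κ'))
    (h₁ : ‖m₁‖ ≤ c) (h₂ : ‖m₂‖ ≤ c) : Factors (c * r) (HS.ket o (mul m₁ m₂) E) := by
  have hr := hE.nonneg
  have hc := (norm_nonneg _).trans h₁
  obtain ⟨x, y, rfl, hx, hy⟩ := hE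
  have hX : Injective fun p : ι × β × κ × (ℕ × ℕ) =>
      ((p.2.2.1, p.2.2.2.1), (p.1, p.2.1, p.2.2.2.2)) :=
    fun p q h => by simp only [Prod.ext_iff] at h ⊢; tauto
  have hY : Injective fun p : ι' × (ℕ × ℕ) × κ' × ρ =>
      ((p.2.1.1, p.2.2.1), (p.1, p.2.1.2, p.2.2.2)) :=
    fun p q h => by simp only [Prod.ext_iff] at h ⊢; tauto
  have hX' : Injective fun p : ι × β × ℕ => (p.1, p.2.1, o.1, p.2.2) :=
    fun p q h => by simp only [Prod.ext_iff] at h ⊢; tauto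
  have hY' : Injective fun p : ι' × ℕ × ρ => (p.1, p.2.1, o.2, p.2.2) :=
    fun p q h => by simp only [Prod.ext_iff] at h ⊢; tauto
  have key : HS.ket o (mul m₁ m₂) (vst x y) =
      vst (pull _ hX (outer m₁ (pull _ hX' x))) (pull _ hY (outer m₂ (pull _ hY' y))) := by
    ext ⟨i, j, k, l⟩
    rw [ket_apply, vst_apply, vst_apply]
    obtain ⟨k₁, k₂⟩ := k
    rw [mul_apply, mul_comm]
    have s₁ := HS.summable_mul (pull (fun c => (k₁, c)) (Prod.mk_right_injective k₁) m₁)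
      (pull (fun c => (c, k₂)) (Prod.mk_left_injective k₂) m₂)
    have s₂ := HS.summable_mul
      (pull (fun c => (i.1, j, o.1, c))
        (fun p q h => by simp only [Prod.ext_iff] at h ⊢; tauto) x)
      (pull (fun c => (i.2, c, o.2, l))
        (fun p q h => by simp only [Prod.ext_iff] at h ⊢; tauto) y)
    refine (tsum_mul_tsum_of_summable_norm s₁.norm s₂.norm).trans (tsum_congr fun s => ?_)
    change (m₁ (k₁, s.1) * m₂ (s.1, k₂)) * (x (i.1, j, o.1, s.2) * y (i.2, s.2, o.2, l)) =
      (m₁ (k₁, s.1) * x (i.1, j, o.1, s.2)) * (m₂ (s.1, k₂) * y (i.2, s.2, o.2, l))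
    ring
  rw [key]
  refine Factors.of_vst _ injective_pair _ _ (by positivity) ?_
  rw [sq]
  refine mul_le_mul ?_ ?_ (norm_nonneg _) (by positivity)
  · refine (norm_pull_le _ _ _).trans ((norm_outer _ _).trans_le ?_)
    exact mul_le_mul h₁ ((norm_pull_le _ _ _).trans hx) (norm_nonneg _) hc
  · refine (norm_pull_le _ _ _).trans ((norm_outer _ _).trans_le ?_)
    exact mul_le_mul h₂ ((norm_pull_le _ _ _).trans hy) (norm_nonneg _) hc

/-- Contracting the two left legs with $m_1m_2$ closes a cycle of four tables. By `tsum_cyclic_comm`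
the cycle may be cut the other way: $m_1$ is absorbed in the upper half, $m_2$ in the lower, and the
pair of bonds between them becomes the new bond. -/
theorem Factors.bra {r c : ℝ} {E : HS ((ι × ι') × β × (κ × κ') × ρ)} [DecidableEq κ]
    [DecidableEq κ'] (hE : Factors r E) (o : κ × κ') (m₁ : HS (κ × ℕ)) (m₂ : HS (ℕ × κ'))
    (h₁ : ‖m₁‖ ≤ c) (h₂ : ‖m₂‖ ≤ c) : Factors (c * r) (HS.bra o (mul m₁ m₂) E) := by
  have hr := hE.nonneg
  have hc := (norm_nonneg _).trans h₁
  obtain ⟨x, y, rfl, hx, hy⟩ := hE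
  have hX : Injective fun p : (ι × β × ℕ) × κ => (p.1.1, p.1.2.1, p.2, p.1.2.2) :=
    fun p q h => by simp only [Prod.ext_iff] at h ⊢; tauto
  have hY : Injective fun p : κ' × (ι' × ℕ × ρ) => (p.2.1, p.2.2.1, p.1, p.2.2.2) :=
    fun p q h => by simp only [Prod.ext_iff] at h ⊢; tauto
  have hX' : Injective fun p : (ι × β × ℕ) × ℕ => (p.1.1, p.1.2.1, o.1, (p.2, p.1.2.2)) :=
    fun p q h => by simp only [Prod.ext_iff] at h ⊢; tauto
  have hY' : Injective fun p : ℕ × (ι' × ℕ × ρ) => (p.2.1, (p.1, p.2.2.1), o.2, p.2.2.2) :=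
    fun p q h => by simp only [Prod.ext_iff] at h ⊢; tauto
  -- The push-forward places the output at left indices `o.1` and `o.2`; everywhere else the result
  -- is zero.
  set x' := push _ hX' (mul (pull _ hX x) m₁) with hx'
  set y' := push _ hY' (mul m₂ (pull _ hY y)) with hy'
  have key : HS.bra o (mul m₁ m₂) (vst x y) = vst x' y' := by
    ext ⟨i, j, k, l⟩
    rw [bra_apply, vst_apply]
    split_ifs with hk
    · subst hk
      have ex : ∀ c, x' (i.1, j, k.1, c) = ∑' a, m₁ (a, c.1) * x (i.1, j, a, c.2) := fun c => by
        refine (push_apply _ hX' _ ((i.1, j, c.2), c.1)).trans ?_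
        rw [mul_apply]
        exact tsum_congr fun a => mul_comm _ _
      have ey : ∀ c, y' (i.2, c, k.2, l) = ∑' b, m₂ (c.1, b) * y (i.2, c.2, b, l) := fun c =>
        push_apply _ hY' _ (c.1, (i.2, c.2, l))
      simp only [ex, ey]
      exact (tsum_cyclic_comm m₁
        (pull (fun p : κ × ℕ => (i.1, j, p.1, p.2))
          (fun p q h => by simp only [Prod.ext_iff] at h ⊢; tauto) x)
        (pull Prod.swap Prod.swap_injective m₂)
        (pull (fun p : κ' × ℕ => (i.2, p.2, p.1, l))
          (fun p q h => by simp only [Prod.ext_iff] at h ⊢; tauto) y)).symm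
    · refine ((tsum_congr fun c => ?_).trans tsum_zero).symm
      by_cases h : k.1 = o.1
      · rw [hy', push_apply_of_notMem _ hY' _ (i.2, c, k.2, l), mul_zero]
        rintro ⟨p, hp⟩
        simp only [Prod.ext_iff] at hp hk
        tauto
      · rw [hx', push_apply_of_notMem _ hX' _ (i.1, j, k.1, c), zero_mul]
        rintro ⟨p, hp⟩
        simp only [Prod.ext_iff] at hp
        tauto
  rw [key]
  refine Factors.of_vst _ injective_pair _ _ (by positivity) ?_
  rw [sq]
  refine mul_le_mul ?_ ?_ (norm_nonneg _) (by positivity)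
  · rw [hx', norm_push, mul_comm c]
    exact (norm_mul_le _ _).trans
      (mul_le_mul ((norm_pull_le _ _ _).trans hx) h₁ (norm_nonneg _) hr)
  · rw [hy', norm_push]
    exact (norm_mul_le _ _).trans
      (mul_le_mul h₂ ((norm_pull_le _ _ _).trans hy) (norm_nonneg _) hc)

end HS

/-! ### Action on the reference components, isometries, and excitation of the vertical legs. -/

namespace HS

open Function

variable {α α' β β' γ ι ι' κ κ' ρ : Type}

theorem norm_rbra_le [DecidableEq ι] (o : ι) (m : HS ι) (x : HS (ι × β × κ × ρ)) :
    ‖rbra o m x‖ ≤ ‖m‖ * ‖x‖ :=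
  (norm_mirror_le _).trans ((norm_bra_le _ _ _).trans
    (mul_le_mul_of_nonneg_left (norm_mirror_le _) (norm_nonneg _)))

theorem norm_rket_le [DecidableEq ι] (o : ι) (m : HS ι) (x : HS (ι × β × κ × ρ)) :
    ‖rket o m x‖ ≤ ‖m‖ * ‖x‖ :=
  (norm_mirror_le _).trans ((norm_ket_le _ _ _).trans
    (mul_le_mul_of_nonneg_left (norm_mirror_le _) (norm_nonneg _)))

theorem rket_apply [DecidableEq ι] (o : ι) (m : HS ι) (x : HS (ι × β × κ × ρ)) (i : ι) (j : β)
    (k : κ) (l : ρ) : rket o m x (i, j, k, l) = x (o, j, k, l) * m i :=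
  ket_apply o m (mirror x) k j i l

theorem mirror_basisVec [DecidableEq ι] [DecidableEq β] [DecidableEq κ] [DecidableEq ρ] (i : ι)
    (j : β) (k : κ) (l : ρ) : mirror (basisVec (i, j, k, l)) = basisVec (k, j, i, l) := by
  ext ⟨i', j', k', l'⟩
  rw [mirror_apply]
  simp only [basisVec_apply, Prod.mk.injEq]
  split_ifs <;> tauto

theorem transp_basisVec [DecidableEq ι] [DecidableEq β] [DecidableEq κ] [DecidableEq ρ] (i : ι)
    (j : β) (k : κ) (l : ρ) : transp (basisVec (i, j, k, l)) = basisVec (j, i, l, k) := by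
  ext ⟨i', j', k', l'⟩
  rw [transp_apply]
  simp only [basisVec_apply, Prod.mk.injEq]
  split_ifs <;> tauto

theorem rbra_basisVec [DecidableEq ι] [DecidableEq β] [DecidableEq κ] [DecidableEq ρ] (o : ι)
    (m : HS ι) (hm : m o = 0) (j : β) (k : κ) (l : ρ) :
    rbra o m (basisVec (o, j, k, l)) = 0 := by
  rw [rbra, LinearMap.comp_apply, LinearMap.comp_apply, mirror_basisVec, bra_basisVec o m hm,
    map_zero]

theorem conjHL_refl (x : HS (α × β × α × ρ)) :
    conjHL (ContinuousLinearEquiv.refl ℝ (HS α)) x = x := by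
  change lact (ContinuousLinearMap.id ℝ (HS α)) (ract (ContinuousLinearMap.id ℝ (HS α)) x) = x
  rw [lact_id, ract_id]

theorem conjVL_refl (x : HS (α × β × κ × β)) :
    conjVL (ContinuousLinearEquiv.refl ℝ (HS β)) x = x := by
  rw [conjVL, conjHL_refl]
  rfl

theorem conjHL_add (F : HS α' ≃L[ℝ] HS α) (x y : HS (α × β × α × ρ)) :
    conjHL F (x + y) = conjHL F x + conjHL F y := by
  simp only [conjHL, map_add]

theorem conjHL_sub (F : HS α' ≃L[ℝ] HS α) (x y : HS (α × β × α × ρ)) :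
    conjHL F (x - y) = conjHL F x - conjHL F y := by
  simp only [conjHL, map_sub]

theorem conjVL_add (F : HS β' ≃L[ℝ] HS β) (x y : HS (α × β × κ × β)) :
    conjVL F (x + y) = conjVL F x + conjVL F y := by
  simp only [conjVL, map_add, conjHL_add]

theorem lact_basisVec [DecidableEq ι] [DecidableEq β] [DecidableEq κ] [DecidableEq κ']
    [DecidableEq ρ] (F : HS κ →L[ℝ] HS κ') (k : κ) (k' : κ') (hF : F (basisVec k) = basisVec k')
    (i : ι) (j : β) (l : ρ) : lact F (basisVec (i, j, k, l)) = basisVec (i, j, k', l) := by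
  ext ⟨i', j', q, l'⟩
  rw [lact_apply]
  by_cases h : i' = i ∧ j' = j ∧ l' = l
  · obtain ⟨rfl, rfl, rfl⟩ := h
    have : leftFibre (basisVec (i', j', k, l')) i' j' l' = basisVec k := by
      ext q
      simp [leftFibre_apply, basisVec_apply]
    rw [this, hF]
    simp [basisVec_apply]
  · have : leftFibre (basisVec (i, j, k, l)) i' j' l' = 0 := by
      ext q
      rw [leftFibre_apply, basisVec_apply, if_neg, zero_apply]
      simp only [Prod.mk.injEq]
      tauto
    rw [this, map_zero, zero_apply, basisVec_apply, if_neg]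
    simp only [Prod.mk.injEq]
    tauto

section isometry

variable (J : HS α' ≃ₗᵢ[ℝ] HS α)

theorem norm_conjHL_le (x : HS (α × β × α × ρ)) :
    ‖conjHL J.toContinuousLinearEquiv x‖ ≤ ‖x‖ := by
  have h₁ : ‖(J.toContinuousLinearEquiv : HS α' →L[ℝ] HS α)‖ ≤ 1 :=
    ContinuousLinearMap.opNorm_le_bound _ zero_le_one fun x => by simp
  have h₂ : ‖(J.toContinuousLinearEquiv.symm : HS α →L[ℝ] HS α')‖ ≤ 1 :=
    ContinuousLinearMap.opNorm_le_bound _ zero_le_one fun x =>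
      ((J.symm.norm_map x).trans (one_mul _).symm).le
  refine (norm_lact_le _ _).trans ((mul_le_of_le_one_left (norm_nonneg _) h₂).trans ?_)
  exact (norm_ract_le _ _).trans (mul_le_of_le_one_left (norm_nonneg _) h₁)

theorem norm_conjVL_le (x : HS (κ × α × ρ × α)) :
    ‖conjVL J.toContinuousLinearEquiv x‖ ≤ ‖x‖ :=
  (norm_transp_le _).trans ((norm_conjHL_le J _).trans (norm_transp_le _))

variable {J} [DecidableEq α] [DecidableEq α'] {o : α} {o' : α'}

theorem adjoint_isometry_basisVec (hJ : J (basisVec o') = basisVec o) :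
    ContinuousLinearMap.adjoint (J.toContinuousLinearEquiv : HS α' →L[ℝ] HS α) (basisVec o) =
      basisVec o' := by
  rw [← hJ]
  refine ext_inner_left ℝ fun v => ?_
  rw [ContinuousLinearMap.adjoint_inner_right]
  exact J.inner_map_map v (basisVec o')

theorem conjHL_basisVec [DecidableEq β] [DecidableEq ρ] (hJ : J (basisVec o') = basisVec o) (j : β)
    (l : ρ) : conjHL J.toContinuousLinearEquiv (basisVec (o, j, o, l)) =
      basisVec (o', j, o', l) := by
  rw [conjHL, ract_eq, mirror_basisVec, lact_basisVec _ o o' (adjoint_isometry_basisVec hJ),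
    mirror_basisVec, lact_basisVec _ o o']
  exact J.symm_apply_eq.2 hJ.symm

theorem conjVL_basisVec [DecidableEq κ] [DecidableEq ρ] (hJ : J (basisVec o') = basisVec o) (i : κ)
    (k : ρ) : conjVL J.toContinuousLinearEquiv (basisVec (i, o, k, o)) =
      basisVec (i, o', k, o') := by
  rw [conjVL, transp_basisVec, conjHL_basisVec hJ, transp_basisVec]

theorem entry_isometry_base (hJ : J (basisVec o') = basisVec o) (p : α) :
    entry (J.toContinuousLinearEquiv : HS α' →L[ℝ] HS α) p o' = if p = o then 1 else 0 := by
  rw [← basisVec_apply, ← hJ]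
  rfl

theorem entry_isometry_symm_base (hJ : J (basisVec o') = basisVec o) (q : α') :
    entry (J.toContinuousLinearEquiv.symm : HS α →L[ℝ] HS α') q o = if q = o' then 1 else 0 := by
  rw [← basisVec_apply, ← J.symm_apply_eq.2 hJ.symm]
  rfl

theorem entry_isometry_base_left (hJ : J (basisVec o') = basisVec o) (q : α') :
    entry (J.toContinuousLinearEquiv : HS α' →L[ℝ] HS α) o q = if q = o' then 1 else 0 := by
  rw [← basisVec_apply, ← adjoint_isometry_basisVec hJ, adjoint_basisVec_apply]

theorem entry_isometry_symm_base_left (hJ : J (basisVec o') = basisVec o) (p : α) :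
    entry (J.toContinuousLinearEquiv.symm : HS α →L[ℝ] HS α') o' p = if p = o then 1 else 0 :=
  entry_isometry_base_left (J := J.symm) (J.symm_apply_eq.2 hJ.symm) p

end isometry

/-- Tables whose top leg is excited and whose bottom leg is not. -/
def OnTop (o : β) (o' : ρ) (x : HS (ι × β × κ × ρ)) : Prop :=
  ∀ i j k l, (j = o ∨ l ≠ o') → x (i, j, k, l) = 0

/-- Tables whose bottom leg is excited and whose top leg is not. -/
def OnBottom (o : β) (o' : ρ) (x : HS (ι × β × κ × ρ)) : Prop :=
  ∀ i j k l, (j ≠ o ∨ l = o') → x (i, j, k, l) = 0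

theorem lact_apply_eq_zero (F : HS κ →L[ℝ] HS κ') (x : HS (ι × β × κ × ρ)) (j : β)
    (l : ρ) (h : ∀ i k, x (i, j, k, l) = 0) (i : ι) (k : κ') : lact F x (i, j, k, l) = 0 := by
  have : leftFibre x i j l = 0 := by
    ext k
    exact h i k
  rw [lact_apply, this, map_zero, zero_apply]

/-- Horizontal conjugation mixes only horizontal indices, so it cannot fill a vertical sector that
is empty. -/
theorem conjHL_apply_eq_zero (F : HS α' ≃L[ℝ] HS α) (x : HS (α × β × α × ρ)) (j : β)
    (l : ρ) (h : ∀ i k, x (i, j, k, l) = 0) (i k : α') : conjHL F x (i, j, k, l) = 0 :=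
  lact_apply_eq_zero _ _ j l
    (fun i k => lact_apply_eq_zero _ (mirror x) j l (fun i k => h k i) k i) i k

theorem OnTop.conjHL {o : β} {o' : ρ} {x : HS (α × β × α × ρ)} (hx : OnTop o o' x)
    (F : HS α' ≃L[ℝ] HS α) : OnTop o o' (conjHL F x) := fun i j k l h =>
  conjHL_apply_eq_zero F x j l (fun i k => hx i j k l h) i k

theorem OnBottom.conjHL {o : β} {o' : ρ} {x : HS (α × β × α × ρ)} (hx : OnBottom o o' x)
    (F : HS α' ≃L[ℝ] HS α) : OnBottom o o' (conjHL F x) := fun i j k l h =>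
  conjHL_apply_eq_zero F x j l (fun i k => hx i j k l h) i k

theorem conjVL_apply [DecidableEq β] [DecidableEq β'] (F : HS β' ≃L[ℝ] HS β)
    (x : HS (α × β × α × β)) (i : α) (j : β') (k : α) (l : β') :
    conjVL F x (i, j, k, l) = ∑' p : β × β, entry (F.symm : HS β →L[ℝ] HS β') l p.1 *
      x (i, p.2, k, p.1) * entry (F : HS β' →L[ℝ] HS β) p.2 j :=
  (congrFun (conjV_coe F x) (i, j, k, l)).symm

/-- An isometry that matches the reference vectors also matches their orthogonal complements; its
matrix therefore has no entries between trivial and excited indices. -/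
theorem OnTop.conjVL [DecidableEq β] [DecidableEq β'] {o : β} {o' : β'} {J : HS β' ≃ₗᵢ[ℝ] HS β}
    (hJ : J (basisVec o') = basisVec o) {x : HS (α × β × α × β)} (hx : OnTop o o x) :
    OnTop o' o' (conjVL J.toContinuousLinearEquiv x) := fun i j k l h => by
  rw [conjVL_apply]
  refine (tsum_congr fun p => ?_).trans tsum_zero
  by_cases hp : p.2 = o ∨ p.1 ≠ o
  · rw [hx _ _ _ _ hp, mul_zero, zero_mul]
  push Not at hp
  rcases h with rfl | h
  · rw [entry_isometry_base hJ, if_neg hp.1, mul_zero]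
  · rw [hp.2, entry_isometry_symm_base hJ, if_neg h, zero_mul, zero_mul]

theorem OnBottom.conjVL [DecidableEq β] [DecidableEq β'] {o : β} {o' : β'} {J : HS β' ≃ₗᵢ[ℝ] HS β}
    (hJ : J (basisVec o') = basisVec o) {x : HS (α × β × α × β)} (hx : OnBottom o o x) :
    OnBottom o' o' (conjVL J.toContinuousLinearEquiv x) := fun i j k l h => by
  rw [conjVL_apply]
  refine (tsum_congr fun p => ?_).trans tsum_zero
  by_cases hp : p.2 ≠ o ∨ p.1 = o
  · rw [hx _ _ _ _ hp, mul_zero, zero_mul]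
  push Not at hp
  rcases h with h | rfl
  · rw [hp.1, entry_isometry_base_left hJ, if_neg h, mul_zero]
  · rw [entry_isometry_symm_base_left hJ, if_neg hp.2, zero_mul, zero_mul]

end HS

/-! ### The gauge step. -/

open Function HS

/-- The horizontal composition of two copies of the fixed tensor. -/
def fixedRow : HS (ℕ × (ℕ × ℕ) × ℕ × (ℕ × ℕ)) := basisVec (0, (0, 0), 0, (0, 0))

/-- The block of the fixed tensor. -/
def fixedBlock : HS ((ℕ × ℕ) × (ℕ × ℕ) × (ℕ × ℕ) × (ℕ × ℕ)) :=
  basisVec ((0, 0), (0, 0), (0, 0), (0, 0))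

@[simp] theorem norm_fixedTensor : ‖fixedTensor‖ = 1 := norm_basisVec _

@[simp] theorem norm_fixedRow : ‖fixedRow‖ = 1 := norm_basisVec _

theorem row_fixedTensor : row fixedTensor fixedTensor = fixedRow := row_basisVec _ _ _ _ _ _ _

theorem vst_fixedRow : vst fixedRow fixedRow = fixedBlock := vst_basisVec _ _ _ _ _ _ _

/-- Indices whose vertical part is trivial, and whose horizontal part is trivial on one side. -/
def gaugeIndices : Set (ℕ × ℕ × ℕ × ℕ) :=
  {p | p.2.1 = 0 ∧ p.2.2.2 = 0 ∧ (p.1 = 0 ∨ p.2.2.1 = 0)}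

/-- A gauge step removes, to first order, the components with a single excited horizontal leg. -/
theorem exists_isGaugeStep (A : Tensor4) (hA : A (0, 0, 0, 0) = 1)
    (h1 : ‖A - fixedTensor‖ ≤ 1) :
    ∃ B : Tensor4, IsGaugeStep A B ∧ ‖B - fixedTensor‖ ≤ 22 * ‖A - fixedTensor‖ ∧
      ‖restr gaugeIndices (B - fixedTensor)‖ ≤ 19 * ‖A - fixedTensor‖ ^ 2 := by
  set d := A - fixedTensor with hd
  have hd0 : d (0, 0, 0, 0) = 0 := by
    rw [hd, sub_apply, hA, fixedTensor, basisVec_apply, if_pos rfl, sub_self]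
  have hm : Injective fun k : ℕ => ((0, 0, k, 0) : ℕ × ℕ × ℕ × ℕ) :=
    fun p q h => by simp only [Prod.ext_iff] at h ⊢; tauto
  have hm' : Injective fun i : ℕ => ((i, 0, 0, 0) : ℕ × ℕ × ℕ × ℕ) :=
    fun p q h => by simp only [Prod.ext_iff] at h ⊢; tauto
  have hn := norm_pull_le _ hm d
  have hn' := norm_pull_le _ hm' d
  -- These are the components to be cancelled, used as the shear vectors: to first order the shear
  -- subtracts `m` on the left leg and `m'` on the right leg of the fixed tensor. The vertical gauge
  -- can stay trivial.
  set m := pull _ hm d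
  set m' := pull _ hm' d
  have hm0 : m 0 = 0 := hd0
  have hm0' : m' 0 = 0 := hd0
  refine ⟨conjVL (ContinuousLinearEquiv.refl ℝ (HS ℕ)) (conjHL (shear 0 m m' hm0 hm0') A),
    ⟨shear 0 m m' hm0 hm0', ContinuousLinearEquiv.refl ℝ (HS ℕ), ?_⟩, ?_⟩
  · rw [conjH_coe, conjV_coe]
  rw [conjVL_refl, conjHL_shear]
  have est := shearProd_estimate (W := Tensor4) (Sz := fun r x => ‖x‖ ≤ r)
    (L₁ := ket 0 m) (L₂ := bra 0 m') (P₁ := rbra 0 m) (P₂ := rket 0 m') (c := ‖d‖) (s := ‖d‖)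
    (e := fixedTensor) (d := d)
    (fun h hx => hx.trans h) (fun hx hy => (norm_add_le _ _).trans (add_le_add hx hy))
    (fun hx => (norm_neg _).trans_le hx) (norm_nonneg _) h1 (norm_nonneg _)
    (fun hx => (norm_ket_le _ _ _).trans (mul_le_mul hn hx (norm_nonneg _) (norm_nonneg _)))
    (fun hx => (norm_bra_le _ _ _).trans (mul_le_mul hn' hx (norm_nonneg _) (norm_nonneg _)))
    (fun hx => (norm_rbra_le _ _ _).trans (mul_le_mul hn hx (norm_nonneg _) (norm_nonneg _)))
    (fun hx => (norm_rket_le _ _ _).trans (mul_le_mul hn' hx (norm_nonneg _) (norm_nonneg _)))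
    norm_fixedTensor.le le_rfl (rbra_basisVec 0 m hm0 _ _ _) (bra_basisVec 0 m' hm0' _ _ _)
  rw [show fixedTensor + d = A by rw [hd]; abel] at est
  set B := shearProd (ket 0 m) (bra 0 m') (rbra 0 m) (rket 0 m') A
  set z := A - ket 0 m fixedTensor - rket 0 m' fixedTensor - fixedTensor with hz
  have hB : B - fixedTensor = (B - (A - ket 0 m fixedTensor - rket 0 m' fixedTensor)) + z := by
    rw [hz]; abel
  -- Here $c=s=\|d\|$, whence $19=15+4$; the constant 22 of the statement adds the 3 from `hzn`.
  have est' : ‖B - (A - ket 0 m fixedTensor - rket 0 m' fixedTensor)‖ ≤ 19 * ‖d‖ ^ 2 :=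
    est.trans_eq (by ring)
  have hzn : ‖z‖ ≤ 3 * ‖d‖ := by
    have hz' : z = d - ket 0 m fixedTensor - rket 0 m' fixedTensor := by rw [hz, hd]; abel
    have h₁ := norm_ket_le 0 m fixedTensor
    have h₂ := norm_rket_le 0 m' fixedTensor
    rw [norm_fixedTensor, mul_one] at h₁ h₂
    rw [hz']
    refine (norm_sub_le _ _).trans ?_
    have := norm_sub_le d (ket 0 m fixedTensor)
    linarith
  have hz0 : restr gaugeIndices z = 0 := by
    ext ⟨i, j, k, l⟩
    rw [restr_apply]
    split_ifs with h
    · obtain ⟨hj, hl, h⟩ := h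
      simp only at hj hl h
      subst hj hl
      have hk : ∀ k, m k = d (0, 0, k, 0) := fun _ => rfl
      have hi : ∀ i, m' i = d (i, 0, 0, 0) := fun _ => rfl
      have hz' : z = d - ket 0 m fixedTensor - rket 0 m' fixedTensor := by rw [hz, hd]; abel
      rw [hz', sub_apply, sub_apply, ket_apply, rket_apply, fixedTensor, basisVec_apply,
        basisVec_apply, hk, hi, zero_apply]
      rcases h with rfl | rfl <;> simp [hd0]
    · rfl
  constructor
  · rw [hB]
    refine (norm_add_le _ _).trans ?_
    nlinarith [norm_nonneg d]
  · rw [hB, map_add, hz0, add_zero]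
    exact (norm_restr_le _ _).trans est'

/-! ### The type I step. -/

/-- Indices for which the vertical legs are both excited or both not excited. -/
def balancedIndices : Set ((ℕ × ℕ) × (ℕ × ℕ) × (ℕ × ℕ) × (ℕ × ℕ)) :=
  {p | p.2.1 = (0, 0) ↔ p.2.2.2 = (0, 0)}

theorem norm_restr_balanced_le {x y : HS ((ℕ × ℕ) × (ℕ × ℕ) × (ℕ × ℕ) × (ℕ × ℕ))}
    (h : ∀ i j k l, (j = (0, 0) ↔ l = (0, 0)) → x (i, j, k, l) = y (i, j, k, l)) :
    ‖restr balancedIndices x‖ ≤ ‖y‖ := by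
  refine norm_le_norm fun ⟨i, j, k, l⟩ => ?_
  rw [restr_apply]
  split_ifs with hs
  · rw [h i j k l hs]
  · simp

theorem norm_vst_le_left (x : HS (ℕ × (ℕ × ℕ) × ℕ × (ℕ × ℕ))) : ‖vst x fixedRow‖ ≤ ‖x‖ :=
  (norm_vst_le _ _).trans_eq (by simp)

theorem norm_vst_le_right (x : HS (ℕ × (ℕ × ℕ) × ℕ × (ℕ × ℕ))) : ‖vst fixedRow x‖ ≤ ‖x‖ :=
  (norm_vst_le _ _).trans_eq (by simp)

theorem norm_row_le_left (x : Tensor4) : ‖row x fixedTensor‖ ≤ ‖x‖ :=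
  (norm_row_le _ _).trans_eq (by simp)

theorem norm_row_le_right (x : Tensor4) : ‖row fixedTensor x‖ ≤ ‖x‖ :=
  (norm_row_le _ _).trans_eq (by simp)

theorem restr_gauge_apply (d : Tensor4) {i k : ℕ} (h : i = 0 ∨ k = 0) :
    restr gaugeIndices d (i, 0, k, 0) = d (i, 0, k, 0) := by
  rw [restr_apply, if_pos]
  exact ⟨rfl, rfl, h⟩

/-- In each of the four terms the vertical side of the block away from the perturbed copy is
trivial. Balance then forces the vertical leg of that copy to be trivial, and one of its horizontal
legs is an inner bond at 0: only gauge components survive, one contribution per corner. -/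
theorem norm_balanced_linear_le (d : Tensor4) :
    ‖restr balancedIndices
      (vst (row d fixedTensor + row fixedTensor d) fixedRow +
        vst fixedRow (row d fixedTensor + row fixedTensor d))‖ ≤
      4 * ‖restr gaugeIndices d‖ := by
  set g := restr gaugeIndices d with hg
  have h₁ : ‖restr balancedIndices (vst (row d fixedTensor) fixedRow)‖ ≤ ‖g‖ := by
    refine (norm_restr_balanced_le (y := vst (row g fixedTensor) fixedRow) ?_).trans
      ((norm_vst_le_left _).trans (norm_row_le_left _))
    rintro i ⟨j₁, j₂⟩ k ⟨l₁, l₂⟩ h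
    simp only [fixedRow, fixedTensor, vst_basisVec_right, row_basisVec_right]
    split_ifs with h' h''
    · rw [h'.2.2] at h
      cases h.2 rfl
      exact (restr_gauge_apply d (Or.inl rfl)).symm
    · rfl
    · rfl
  have h₂ : ‖restr balancedIndices (vst (row fixedTensor d) fixedRow)‖ ≤ ‖g‖ := by
    refine (norm_restr_balanced_le (y := vst (row fixedTensor g) fixedRow) ?_).trans
      ((norm_vst_le_left _).trans (norm_row_le_right _))
    rintro i ⟨j₁, j₂⟩ k ⟨l₁, l₂⟩ h
    simp only [fixedRow, fixedTensor, vst_basisVec_right, row_basisVec_left]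
    split_ifs with h' h''
    · rw [h'.2.2] at h
      cases h.2 rfl
      exact (restr_gauge_apply d (Or.inr rfl)).symm
    · rfl
    · rfl
  have h₃ : ‖restr balancedIndices (vst fixedRow (row d fixedTensor))‖ ≤ ‖g‖ := by
    refine (norm_restr_balanced_le (y := vst fixedRow (row g fixedTensor)) ?_).trans
      ((norm_vst_le_right _).trans (norm_row_le_left _))
    rintro i ⟨j₁, j₂⟩ k ⟨l₁, l₂⟩ h
    simp only [fixedRow, fixedTensor, vst_basisVec_left, row_basisVec_right]
    split_ifs with h' h''
    · rw [h'.2.2] at h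
      cases h.1 rfl
      exact (restr_gauge_apply d (Or.inl rfl)).symm
    · rfl
    · rfl
  have h₄ : ‖restr balancedIndices (vst fixedRow (row fixedTensor d))‖ ≤ ‖g‖ := by
    refine (norm_restr_balanced_le (y := vst fixedRow (row fixedTensor g)) ?_).trans
      ((norm_vst_le_right _).trans (norm_row_le_right _))
    rintro i ⟨j₁, j₂⟩ k ⟨l₁, l₂⟩ h
    simp only [fixedRow, fixedTensor, vst_basisVec_left, row_basisVec_left]
    split_ifs with h' h''
    · rw [h'.2.2] at h
      cases h.1 rfl
      exact (restr_gauge_apply d (Or.inr rfl)).symm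
    · rfl
    · rfl
  simp only [map_add, LinearMap.add_apply]
  refine (norm_add_le _ _).trans ?_
  have := norm_add_le (restr balancedIndices (vst (row d fixedTensor) fixedRow))
    (restr balancedIndices (vst (row fixedTensor d) fixedRow))
  have := norm_add_le (restr balancedIndices (vst fixedRow (row d fixedTensor)))
    (restr balancedIndices (vst fixedRow (row fixedTensor d)))
  linarith

/-- The components of a block with an excited top leg and a trivial bottom leg. -/
def topIndices : Set ((ℕ × ℕ) × (ℕ × ℕ) × (ℕ × ℕ) × (ℕ × ℕ)) :=
  {p | p.2.1 ≠ (0, 0) ∧ p.2.2.2 = (0, 0)}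

/-- The components of a block with an excited bottom leg and a trivial top leg. -/
def bottomIndices : Set ((ℕ × ℕ) × (ℕ × ℕ) × (ℕ × ℕ) × (ℕ × ℕ)) :=
  {p | p.2.1 = (0, 0) ∧ p.2.2.2 ≠ (0, 0)}

theorem restr_top_add_bottom_add_balanced
    (x : HS ((ℕ × ℕ) × (ℕ × ℕ) × (ℕ × ℕ) × (ℕ × ℕ))) :
    restr topIndices x + restr bottomIndices x + restr balancedIndices x = x := by
  ext ⟨i, j, k, l⟩
  simp only [add_apply, restr_apply, topIndices, bottomIndices, balancedIndices,
    Set.mem_ofPred_eq]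
  by_cases hj : j = (0, 0) <;> by_cases hl : l = (0, 0) <;> simp [hj, hl]

theorem isTypeIStep_conj (J : HS ℕ ≃ₗᵢ[ℝ] HS (ℕ × ℕ)) (A : Tensor4) :
    IsTypeIStep J A (conjVL J.toContinuousLinearEquiv
      (conjHL J.toContinuousLinearEquiv (vst (row A A) (row A A)))) := by
  rw [IsTypeIStep, block_coe, conjH_coe, conjV_coe]

/-- The result of a type I step is, to first order, supported on the components for which exactly
one of the two vertical legs is excited. -/
theorem exists_isTypeIStep {J : HS ℕ ≃ₗᵢ[ℝ] HS (ℕ × ℕ)} (hJ : J (basisVec 0) = basisVec (0, 0))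
    (A : Tensor4) {η : ℝ} (hη : η ≤ 1) (hA : ‖A - fixedTensor‖ ≤ η)
    (hA' : ‖restr gaugeIndices (A - fixedTensor)‖ ≤ η ^ 2) :
    ∃ B κt κb ω : Tensor4, IsTypeIStep J A B ∧ B = fixedTensor + κt + κb + ω ∧
      OnTop 0 0 κt ∧ OnBottom 0 0 κb ∧ ‖κt‖ ≤ 15 * η ∧ ‖κb‖ ≤ 15 * η ∧ ‖ω‖ ≤ 15 * η ^ 2 := by
  set d := A - fixedTensor with hd
  have hη0 : 0 ≤ η := (norm_nonneg _).trans hA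
  have hAd : A = fixedTensor + d := by rw [hd]; abel
  set u := row d fixedTensor + row fixedTensor d with hu
  set q := row d d with hq
  have hρ : row A A = fixedRow + u + q := by
    rw [hAd, hu, hq, ← row_fixedTensor]
    simp only [map_add, LinearMap.add_apply]
    abel
  have hun : ‖u‖ ≤ 2 * η := by
    have h₁ := norm_row_le_left d
    have h₂ := norm_row_le_right d
    refine (norm_add_le _ _).trans ?_
    linarith
  have hqn : ‖q‖ ≤ η ^ 2 := (norm_row_le d d).trans (by nlinarith [norm_nonneg d])
  set T := vst (row A A) (row A A) with hT
  -- All terms of order two or more: the two linear in $q$ have norm at most $\eta^2$ each, and the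
  -- product has norm at most $(3\eta)^2$, giving 11.
  set r := vst q fixedRow + vst fixedRow q + vst (u + q) (u + q) with hr
  have hTr : T - fixedBlock = (vst u fixedRow + vst fixedRow u) + r := by
    rw [hT, hρ, hr, ← vst_fixedRow]
    simp only [map_add, LinearMap.add_apply]
    abel
  have hrn : ‖r‖ ≤ 11 * η ^ 2 := by
    have h₁ := norm_vst_le_left q
    have h₂ := norm_vst_le_right q
    have h₃ : ‖u + q‖ ≤ 3 * η := (norm_add_le _ _).trans (by nlinarith)
    have h₄ := norm_vst_le (u + q) (u + q)
    have h₅ : ‖u + q‖ * ‖u + q‖ ≤ (3 * η) * (3 * η) :=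
      mul_le_mul h₃ h₃ (norm_nonneg _) (by positivity)
    have h₆ := norm_add₃_le (a := vst q fixedRow) (b := vst fixedRow q)
      (c := vst (u + q) (u + q))
    nlinarith
  have hTn : ‖T - fixedBlock‖ ≤ 15 * η := by
    rw [hTr]
    have h₁ := norm_vst_le_left u
    have h₂ := norm_vst_le_right u
    have h₃ := norm_add₃_le (a := vst u fixedRow) (b := vst fixedRow u) (c := r)
    nlinarith
  have hbal : ‖restr balancedIndices (T - fixedBlock)‖ ≤ 15 * η ^ 2 := by
    rw [hTr, map_add]
    have h₁ := norm_balanced_linear_le d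
    have h₂ := (norm_restr_le balancedIndices r).trans hrn
    refine (norm_add_le _ _).trans ?_
    rw [← hu] at h₁
    linarith
  set cj : HS ((ℕ × ℕ) × (ℕ × ℕ) × (ℕ × ℕ) × (ℕ × ℕ)) → Tensor4 := fun x =>
    conjVL J.toContinuousLinearEquiv (conjHL J.toContinuousLinearEquiv x) with hcj
  have hcadd : ∀ x y, cj (x + y) = cj x + cj y := fun x y => by
    simp only [hcj, conjHL_add, conjVL_add]
  have hcn : ∀ x, ‖cj x‖ ≤ ‖x‖ := fun x => (norm_conjVL_le J _).trans (norm_conjHL_le J _)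
  have hcf : cj fixedBlock = fixedTensor := by
    change conjVL _ (conjHL _ (basisVec _)) = _
    rw [conjHL_basisVec hJ, conjVL_basisVec hJ]
    rfl
  refine ⟨cj T, cj (restr topIndices (T - fixedBlock)), cj (restr bottomIndices (T - fixedBlock)),
    cj (restr balancedIndices (T - fixedBlock)), isTypeIStep_conj J A, ?_, ?_, ?_,
    (hcn _).trans ((norm_restr_le _ _).trans hTn), (hcn _).trans ((norm_restr_le _ _).trans hTn),
    (hcn _).trans hbal⟩
  · rw [← hcf, ← hcadd, ← hcadd, ← hcadd, add_assoc, add_assoc, ← add_assoc (restr topIndices _),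
      restr_top_add_bottom_add_balanced]
    congr 1
    abel
  · refine OnTop.conjVL hJ (OnTop.conjHL ?_ _)
    intro i j k l h
    rw [restr_apply, if_neg]
    rintro ⟨h₁, h₂⟩
    simp only at h₁ h₂
    tauto
  · refine OnBottom.conjVL hJ (OnBottom.conjHL ?_ _)
    intro i j k l h
    rw [restr_apply, if_neg]
    rintro ⟨h₁, h₂⟩
    simp only at h₁ h₂
    tauto

/-! ### Shear vectors made orthogonal to the reference vector. -/

namespace HS

open Function

variable {β γ δ ι ι' κ κ' ρ : Type}

theorem mul_basisVec [DecidableEq κ] [DecidableEq κ'] [DecidableEq γ] (o : κ × κ') (c : γ) :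
    mul (basisVec (o.1, c)) (basisVec (c, o.2)) = basisVec o := by
  ext ⟨k, k'⟩
  rw [mul_apply, tsum_eq_single c]
  · simp only [basisVec_apply, Prod.ext_iff]
    split_ifs <;> simp_all
  · intro b hb
    simp [basisVec_apply, hb]

theorem abs_mul_apply_le {c : ℝ} {m₁ : HS (κ × γ)} {m₂ : HS (γ × κ')} (h₁ : ‖m₁‖ ≤ c)
    (h₂ : ‖m₂‖ ≤ c) (o : κ × κ') : |mul m₁ m₂ o| ≤ c ^ 2 := by
  refine (abs_apply_le _ _).trans ((norm_mul_le _ _).trans ?_)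
  rw [sq]
  exact mul_le_mul h₁ h₂ (norm_nonneg _) ((norm_nonneg _).trans h₁)

/-- A vector with its component along `o` removed. -/
def deflate [DecidableEq κ] (o : κ) (m : HS κ) : HS κ := m - m o • basisVec o

theorem deflate_self [DecidableEq κ] (o : κ) (m : HS κ) : deflate o m o = 0 := by
  simp [deflate, basisVec_apply]

/-- The subtracted term is a ket along $e_o$, which factors through a one-dimensional bond; its
coefficient is at most $c^2$ and costs another factor $c$ on each half. -/
theorem Factors.ket_deflate {r c : ℝ} {E : HS ((ι × ι') × β × (κ × κ') × ρ)} [DecidableEq κ]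
    [DecidableEq κ'] (hE : Factors r E) (o : κ × κ') (m₁ : HS (κ × ℕ)) (m₂ : HS (ℕ × κ'))
    (h₁ : ‖m₁‖ ≤ c) (h₂ : ‖m₂‖ ≤ c) :
    Factors (2 * c * r) (HS.ket o (deflate o (mul m₁ m₂)) E) := by
  rw [deflate, ket_sub_smul]
  have h := (hE.ket o (basisVec (o.1, 0)) (basisVec (0, o.2)) (norm_basisVec _).le
    (norm_basisVec _).le).smul ((norm_nonneg _).trans h₁) (abs_mul_apply_le h₁ h₂ o)
  rw [mul_basisVec] at h
  exact ((hE.ket o m₁ m₂ h₁ h₂).sub h).mono (by linarith)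

theorem Factors.bra_deflate {r c : ℝ} {E : HS ((ι × ι') × β × (κ × κ') × ρ)} [DecidableEq κ]
    [DecidableEq κ'] (hE : Factors r E) (o : κ × κ') (m₁ : HS (κ × ℕ)) (m₂ : HS (ℕ × κ'))
    (h₁ : ‖m₁‖ ≤ c) (h₂ : ‖m₂‖ ≤ c) :
    Factors (2 * c * r) (HS.bra o (deflate o (mul m₁ m₂)) E) := by
  rw [deflate, bra_sub_smul]
  have h := (hE.bra o (basisVec (o.1, 0)) (basisVec (0, o.2)) (norm_basisVec _).le
    (norm_basisVec _).le).smul ((norm_nonneg _).trans h₁) (abs_mul_apply_le h₁ h₂ o)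
  rw [mul_basisVec] at h
  exact ((hE.bra o m₁ m₂ h₁ h₂).sub h).mono (by linarith)

theorem rket_deflate [DecidableEq ι] (o : ι) (m : HS ι) (x : HS (ι × β × κ × ρ)) :
    rket o (deflate o m) x = rket o m x - m o • rket o (basisVec o) x := by
  ext ⟨i, j, k, l⟩
  simp only [deflate, rket_apply, sub_apply, smul_apply]
  ring

theorem ket_basisVec_self [DecidableEq ι] [DecidableEq β] [DecidableEq κ] [DecidableEq ρ] (i : ι)
    (j : β) (o : κ) (l : ρ) :
    ket o (basisVec o) (basisVec (i, j, o, l)) = basisVec (i, j, o, l) := by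
  ext ⟨i', j', k', l'⟩
  rw [ket_apply]
  simp only [basisVec_apply, Prod.mk.injEq]
  split_ifs <;> simp_all

theorem rket_basisVec_self [DecidableEq ι] [DecidableEq β] [DecidableEq κ] [DecidableEq ρ] (o : ι)
    (j : β) (k : κ) (l : ρ) :
    rket o (basisVec o) (basisVec (o, j, k, l)) = basisVec (o, j, k, l) := by
  ext ⟨i', j', k', l'⟩
  rw [rket_apply]
  simp only [basisVec_apply, Prod.mk.injEq]
  split_ifs <;> simp_all

theorem pushTop_basisVec [DecidableEq ι] [DecidableEq γ] [DecidableEq δ] [DecidableEq κ]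
    [DecidableEq ρ] (f : γ → δ) (hf : Injective f) (i : ι) (c : γ) (k : κ) (l : ρ) :
    pushTop f hf (basisVec (i, c, k, l)) = basisVec (i, f c, k, l) :=
  push_basisVec _ (fun p q h => by simp only [Prod.ext_iff, hf.eq_iff] at h ⊢; tauto) _

theorem pushBottom_basisVec [DecidableEq ι] [DecidableEq γ] [DecidableEq δ] [DecidableEq κ]
    [DecidableEq β] (f : γ → δ) (hf : Injective f) (i : ι) (j : β) (k : κ) (c : γ) :
    pushBottom f hf (basisVec (i, j, k, c)) = basisVec (i, j, k, f c) :=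
  push_basisVec _ (fun p q h => by simp only [Prod.ext_iff, hf.eq_iff] at h ⊢; tauto) _

end HS

/-! ### The disentangler and the type II step. -/

open Function HS

/-- The part of the row of a perturbed fixed tensor that is linear in the perturbation. -/
def linearRow (d : Tensor4) : HS (ℕ × (ℕ × ℕ) × ℕ × (ℕ × ℕ)) :=
  row d fixedTensor + row fixedTensor d

theorem norm_linearRow_le (d : Tensor4) : ‖linearRow d‖ ≤ 2 * ‖d‖ := by
  have h₁ := norm_row_le_left d
  have h₂ := norm_row_le_right d
  refine (norm_add_le _ _).trans ?_
  linarith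

theorem linearRow_apply (d : Tensor4) (i : ℕ) (j : ℕ × ℕ) (k : ℕ) (l : ℕ × ℕ) :
    linearRow d (i, j, k, l) = (if i = 0 ∧ j.2 = 0 ∧ l.2 = 0 then d (0, j.1, k, l.1) else 0) +
      if k = 0 ∧ j.1 = 0 ∧ l.1 = 0 then d (i, j.2, 0, l.2) else 0 := by
  rw [linearRow, HS.add_apply]
  simp only [fixedTensor, row_basisVec_right, row_basisVec_left]

theorem HS.OnTop.linearRow {d : Tensor4} (hd : OnTop 0 0 d) :
    OnTop (0, 0) (0, 0) (linearRow d) := by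
  rintro i ⟨j₁, j₂⟩ k ⟨l₁, l₂⟩ h
  rw [linearRow_apply]
  have h₁ : (j₂ = 0 ∧ l₂ = 0) → d (0, j₁, k, l₁) = 0 := fun h' => hd _ _ _ _ (by
    rcases h with h | h
    · exact Or.inl (by simp_all)
    · exact Or.inr fun h0 => h (by simp_all))
  have h₂ : (j₁ = 0 ∧ l₁ = 0) → d (i, j₂, 0, l₂) = 0 := fun h' => hd _ _ _ _ (by
    rcases h with h | h
    · exact Or.inl (by simp_all)
    · exact Or.inr fun h0 => h (by simp_all))
  split_ifs with a b b
  · rw [h₁ a.2, h₂ b.2, add_zero]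
  · rw [h₁ a.2, add_zero]
  · rw [h₂ b.2, add_zero]
  · rw [add_zero]

theorem HS.OnBottom.linearRow {d : Tensor4} (hd : OnBottom 0 0 d) :
    OnBottom (0, 0) (0, 0) (linearRow d) := by
  rintro i ⟨j₁, j₂⟩ k ⟨l₁, l₂⟩ h
  rw [linearRow_apply]
  have h₁ : (j₂ = 0 ∧ l₂ = 0) → d (0, j₁, k, l₁) = 0 := fun h' => hd _ _ _ _ (by
    rcases h with h | h
    · exact Or.inl fun h0 => h (by simp_all)
    · exact Or.inr (by simp_all))
  have h₂ : (j₁ = 0 ∧ l₁ = 0) → d (i, j₂, 0, l₂) = 0 := fun h' => hd _ _ _ _ (by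
    rcases h with h | h
    · exact Or.inl fun h0 => h (by simp_all)
    · exact Or.inr (by simp_all))
  split_ifs with a b b
  · rw [h₁ a.2, h₂ b.2, add_zero]
  · rw [h₁ a.2, add_zero]
  · rw [h₂ b.2, add_zero]
  · rw [add_zero]

theorem injective_leftBottom :
    Injective fun p : ℕ × ℕ => ((0, 0, p.1, p.2) : ℕ × ℕ × ℕ × ℕ) :=
  fun p q h => by simp only [Prod.ext_iff] at h ⊢; tauto

theorem injective_topLeft :
    Injective fun p : ℕ × ℕ => ((0, p.1, p.2, 0) : ℕ × ℕ × ℕ × ℕ) :=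
  fun p q h => by simp only [Prod.ext_iff] at h ⊢; tauto

theorem injective_rightBottom :
    Injective fun p : ℕ × ℕ => ((p.1, 0, 0, p.2) : ℕ × ℕ × ℕ × ℕ) :=
  fun p q h => by simp only [Prod.ext_iff] at h ⊢; tauto

theorem injective_topRight :
    Injective fun p : ℕ × ℕ => ((p.2, p.1, 0, 0) : ℕ × ℕ × ℕ × ℕ) :=
  fun p q h => by simp only [Prod.ext_iff] at h ⊢; tauto

/-- The lower corners of the upper row, contracted with the upper corners of the lower row, only
couple the two left legs with each other and the two right legs with each other. -/
theorem vst_linearRow_linearRow {t b : Tensor4} (ht : OnTop 0 0 t) (hb : OnBottom 0 0 b) :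
    vst (linearRow b) (linearRow t) =
      ket (0, 0) (mul (pull _ injective_leftBottom b) (pull _ injective_topLeft t)) fixedBlock +
      rket (0, 0) (mul (pull _ injective_rightBottom b) (pull _ injective_topRight t))
        fixedBlock := by
  -- The excitation on the shared bond leaves the upper row in one column and would have to enter
  -- the lower row in the other, where the bond is trivial.
  have h₁₂ : vst (row b fixedTensor) (row fixedTensor t) = 0 := by
    refine vst_eq_zero _ _ fun i j k c i' k' l => ?_
    simp only [fixedTensor, row_basisVec_right, row_basisVec_left]
    by_cases hc : c.1 = 0
    · left
      rw [hc]
      split_ifs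
      · exact hb _ _ _ _ (Or.inr rfl)
      · rfl
    · right
      rw [if_neg]
      tauto
  have h₂₁ : vst (row fixedTensor b) (row t fixedTensor) = 0 := by
    refine vst_eq_zero _ _ fun i j k c i' k' l => ?_
    simp only [fixedTensor, row_basisVec_right, row_basisVec_left]
    by_cases hc : c.2 = 0
    · left
      rw [hc]
      split_ifs
      · exact hb _ _ _ _ (Or.inr rfl)
      · rfl
    · right
      rw [if_neg]
      tauto
  have h₁₁ : vst (row b fixedTensor) (row t fixedTensor) =
      ket (0, 0) (mul (pull _ injective_leftBottom b) (pull _ injective_topLeft t))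
        fixedBlock := by
    ext ⟨⟨i₁, i₂⟩, ⟨j₁, j₂⟩, ⟨k₁, k₂⟩, ⟨l₁, l₂⟩⟩
    rw [vst_apply, ket_apply, fixedBlock, basisVec_apply]
    simp only [fixedTensor, row_basisVec_right]
    by_cases h : i₁ = 0 ∧ i₂ = 0 ∧ j₁ = 0 ∧ j₂ = 0 ∧ l₁ = 0 ∧ l₂ = 0
    · obtain ⟨rfl, rfl, rfl, rfl, rfl, rfl⟩ := h
      rw [if_pos rfl, one_mul, mul_apply, ← (Prod.mk_left_injective (0 : ℕ)).tsum_eq]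
      · simp only [true_and, if_true]
        rfl
      · rintro ⟨c₁, c₂⟩ hc
        refine ⟨c₁, ?_⟩
        by_contra h
        refine hc ?_
        have : c₂ ≠ 0 := fun h0 => h (by rw [h0])
        simp [this]
    · rw [if_neg (by simp only [Prod.mk.injEq]; tauto), zero_mul]
      refine (tsum_congr fun c => ?_).trans tsum_zero
      split_ifs with a a'
      · by_cases hj : j₁ = 0
        · rw [ht _ _ _ l₁ (Or.inr (by tauto)), mul_zero]
        · rw [hb _ _ _ _ (Or.inl hj), zero_mul]
      · rw [mul_zero]
      · rw [zero_mul]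
      · rw [zero_mul]
  have h₂₂ : vst (row fixedTensor b) (row fixedTensor t) =
      rket (0, 0) (mul (pull _ injective_rightBottom b) (pull _ injective_topRight t))
        fixedBlock := by
    ext ⟨⟨i₁, i₂⟩, ⟨j₁, j₂⟩, ⟨k₁, k₂⟩, ⟨l₁, l₂⟩⟩
    rw [vst_apply, rket_apply, fixedBlock, basisVec_apply]
    simp only [fixedTensor, row_basisVec_left]
    by_cases h : k₁ = 0 ∧ k₂ = 0 ∧ j₁ = 0 ∧ j₂ = 0 ∧ l₁ = 0 ∧ l₂ = 0
    · obtain ⟨rfl, rfl, rfl, rfl, rfl, rfl⟩ := h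
      rw [if_pos rfl, one_mul, mul_apply, ← (Prod.mk_right_injective (0 : ℕ)).tsum_eq]
      · simp only [if_true, and_true]
        rfl
      · rintro ⟨c₁, c₂⟩ hc
        refine ⟨c₂, ?_⟩
        by_contra h
        refine hc ?_
        have : c₁ ≠ 0 := fun h0 => h (by rw [h0])
        simp [this]
    · rw [if_neg (by simp only [Prod.mk.injEq]; tauto), zero_mul]
      refine (tsum_congr fun c => ?_).trans tsum_zero
      split_ifs with a a'
      · by_cases hj : j₂ = 0
        · rw [ht _ _ _ l₂ (Or.inr (by tauto)), mul_zero]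
        · rw [hb _ _ _ _ (Or.inl hj), zero_mul]
      · rw [mul_zero]
      · rw [zero_mul]
      · rw [zero_mul]
  rw [linearRow, linearRow]
  simp only [map_add, LinearMap.add_apply]
  rw [h₁₁, h₁₂, h₂₁, h₂₂]
  abel

set_option maxHeartbeats 800000 in
/-- The disentangler of a block: it acts on the pair of horizontal bonds, and removes the coupling
between the upper and the lower half that the corners of the tensors produce. -/
theorem exists_disentangler {t b w : Tensor4} {η : ℝ} (hη : η ≤ 1 / 2) (ht : OnTop 0 0 t)
    (hb : OnBottom 0 0 b) (htn : ‖t‖ ≤ η) (hbn : ‖b‖ ≤ η) (hwn : ‖w‖ ≤ η ^ 2) :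
    ∃ (R : HS (ℕ × ℕ) ≃L[ℝ] HS (ℕ × ℕ)) (x y : HS (ℕ × (ℕ × ℕ) × ℕ × (ℕ × ℕ)))
      (E : HS ((ℕ × ℕ) × (ℕ × ℕ) × (ℕ × ℕ) × (ℕ × ℕ))),
      conjHL R (vst (row (fixedTensor + t + b + w) (fixedTensor + t + b + w))
        (row (fixedTensor + t + b + w) (fixedTensor + t + b + w))) =
        vst (fixedRow + linearRow t + x) (fixedRow + linearRow b + y) + E ∧
      ‖x‖ ≤ 13 * η ^ 2 ∧ ‖y‖ ≤ 11 * η ^ 2 ∧ Factors (632 * √η ^ 3) E := by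
  have hη0 : 0 ≤ η := (norm_nonneg _).trans htn
  set θ := √η with hθ
  have hθη : θ ^ 2 = η := Real.sq_sqrt hη0
  have hθ0 : 0 ≤ θ := Real.sqrt_nonneg _
  have hθ1 : θ ≤ 1 := by nlinarith
  set u := linearRow t with hu
  set v := linearRow b with hv
  have hun : ‖u‖ ≤ 2 * η := (norm_linearRow_le t).trans (by linarith)
  have hvn : ‖v‖ ≤ 2 * η := (norm_linearRow_le b).trans (by linarith)
  have hut : OnTop (0, 0) (0, 0) u := ht.linearRow
  have hvb : OnBottom (0, 0) (0, 0) v := hb.linearRow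
  set d := t + b + w with hd
  set y := linearRow w + row d d with hy
  have hdn : ‖d‖ ≤ 3 * η := norm_add₃_le.trans (by nlinarith)
  have hyn : ‖y‖ ≤ 11 * η ^ 2 := by
    have h₁ := norm_linearRow_le w
    have h₂ := norm_row_le d d
    have h₃ : ‖d‖ * ‖d‖ ≤ (3 * η) * (3 * η) := mul_le_mul hdn hdn (norm_nonneg _) (by positivity)
    refine (norm_add_le _ _).trans ?_
    nlinarith
  have hρ : row (fixedTensor + t + b + w) (fixedTensor + t + b + w) = fixedRow + u + v + y := by
    rw [hy, hu, hv, linearRow, linearRow, linearRow, hd, ← row_fixedTensor]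
    simp only [map_add, LinearMap.add_apply]
    abel
  rw [hρ]
  -- The four vanishing products: the bond between the rows would have to be trivial and excited at
  -- once.
  have heu : vst fixedRow u = 0 := vst_eq_zero _ _ fun i j k c i' k' l => by
    by_cases hc : c = (0, 0)
    · exact Or.inr (hut _ _ _ _ (Or.inl hc))
    · left
      rw [fixedRow, basisVec_apply, if_neg]
      simp only [Prod.mk.injEq] at hc ⊢
      tauto
  have hve : vst v fixedRow = 0 := vst_eq_zero _ _ fun i j k c i' k' l => by
    by_cases hc : c = (0, 0)
    · exact Or.inl (hvb _ _ _ _ (Or.inr hc))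
    · right
      rw [fixedRow, basisVec_apply, if_neg]
      simp only [Prod.mk.injEq] at hc ⊢
      tauto
  have huu : vst u u = 0 := vst_eq_zero _ _ fun i j k c i' k' l => by
    by_cases hc : c = (0, 0)
    · exact Or.inr (hut _ _ _ _ (Or.inl hc))
    · exact Or.inl (hut _ _ _ _ (Or.inr hc))
  have hvv : vst v v = 0 := vst_eq_zero _ _ fun i j k c i' k' l => by
    by_cases hc : c = (0, 0)
    · exact Or.inl (hvb _ _ _ _ (Or.inr hc))
    · exact Or.inr (hvb _ _ _ _ (Or.inl hc))
  set T := vst (fixedRow + u + v + y) (fixedRow + u + v + y) with hT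
  have hTe : T = vst (fixedRow + u + y) (fixedRow + v + y) + vst v u + vst v y + vst y u := by
    rw [hT]
    simp only [map_add, LinearMap.add_apply, heu, hve, huu, hvv]
    abel
  set l₁ := pull _ injective_leftBottom b
  set l₂ := pull _ injective_topLeft t
  set r₁ := pull _ injective_rightBottom b
  set r₂ := pull _ injective_topRight t
  have hl₁ : ‖l₁‖ ≤ η := (norm_pull_le _ injective_leftBottom _).trans hbn
  have hl₂ : ‖l₂‖ ≤ η := (norm_pull_le _ injective_topLeft _).trans htn
  have hr₁ : ‖r₁‖ ≤ η := (norm_pull_le _ injective_rightBottom _).trans hbn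
  have hr₂ : ‖r₂‖ ≤ η := (norm_pull_le _ injective_topRight _).trans htn
  have hvu : vst v u = ket (0, 0) (mul l₁ l₂) fixedBlock + rket (0, 0) (mul r₁ r₂) fixedBlock :=
    vst_linearRow_linearRow ht hb
  have heF : Factors 1 fixedBlock := by
    rw [← vst_fixedRow]
    exact Factors.of_vst _ injective_pair _ _ zero_le_one (by simp)
  -- A product of norm $O(\eta)$ splits into halves of size $O(\theta)$ with $\theta=\sqrt\eta$.
  have hdF : Factors (20 * θ) (T - fixedBlock) := by
    have hs : ‖u + v + y‖ ≤ 15 * η := norm_add₃_le.trans (by nlinarith)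
    have hs' : ‖fixedRow + (u + v + y)‖ ≤ 16 := by
      refine (norm_add_le _ _).trans ?_
      rw [norm_fixedRow]
      linarith
    have e : T - fixedBlock = vst (u + v + y) (fixedRow + (u + v + y)) +
        vst fixedRow (u + v + y) := by
      rw [hT, ← vst_fixedRow]
      simp only [map_add, LinearMap.add_apply]
      abel
    rw [e]
    refine ((Factors.of_vst _ injective_pair _ _ (r := 16 * θ) (by positivity) ?_).add
      (Factors.of_vst _ injective_pair _ _ (r := 4 * θ) (by positivity) ?_)).mono (by linarith)
    · rw [mul_pow, hθη]
      refine (mul_le_mul hs hs' (norm_nonneg _) (by positivity)).trans ?_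
      linarith
    · rw [mul_pow, hθη, norm_fixedRow]
      linarith
  -- The shear vectors are the two coupling vectors of $vu$ with their $(0,0)$ entries removed, so
  -- that the shear is invertible. Here $c=2\eta$ because each vector factors through halves of size
  -- $\eta$ and deflation doubles the cost.
  have est := shearProd_estimate (Sz := Factors (ι := ℕ) (ι' := ℕ) (κ := ℕ) (κ' := ℕ)
      (β := ℕ × ℕ) (ρ := ℕ × ℕ))
    (L₁ := ket (0, 0) (deflate (0, 0) (mul l₁ l₂)))
    (L₂ := bra (0, 0) (deflate (0, 0) (mul r₁ r₂)))
    (P₁ := rbra (0, 0) (deflate (0, 0) (mul l₁ l₂)))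
    (P₂ := rket (0, 0) (deflate (0, 0) (mul r₁ r₂)))
    (c := 2 * η) (s := 20 * θ) (e := fixedBlock) (d := T - fixedBlock)
    (fun h hx => hx.mono h) (fun hx hy => hx.add hy) (fun hx => hx.neg)
    (by positivity) (by linarith) (by positivity)
    (fun hx => hx.ket_deflate _ _ _ hl₁ hl₂) (fun hx => hx.bra_deflate _ _ _ hr₁ hr₂)
    (fun hx => (hx.mirror.bra_deflate _ _ _ hl₁ hl₂).mirror)
    (fun hx => (hx.mirror.ket_deflate _ _ _ hr₁ hr₂).mirror)
    heF hdF (rbra_basisVec _ _ (deflate_self _ _) _ _ _) (bra_basisVec _ _ (deflate_self _ _) _ _ _)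
  rw [← conjHL_shear (0, 0) _ _ (deflate_self _ _) (deflate_self _ _), add_sub_cancel] at est
  set R := shear (0, 0) (deflate (0, 0) (mul l₁ l₂)) (deflate (0, 0) (mul r₁ r₂))
    (deflate_self _ _) (deflate_self _ _)
  set μl := mul l₁ l₂ (0, 0) with hμl
  set μr := mul r₁ r₂ (0, 0) with hμr
  have hμ : |μl + μr| ≤ 2 * η ^ 2 := by
    have h₁ := abs_mul_apply_le hl₁ hl₂ (0, 0)
    have h₂ := abs_mul_apply_le hr₁ hr₂ (0, 0)
    refine (abs_add_le _ _).trans ?_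
    rw [hμl, hμr]
    linarith
  have hkl : ket (0, 0) (deflate (0, 0) (mul l₁ l₂)) fixedBlock =
      ket (0, 0) (mul l₁ l₂) fixedBlock - μl • fixedBlock := by
    rw [deflate, ket_sub_smul]
    congr 2
    exact ket_basisVec_self _ _ _ _
  have hkr : rket (0, 0) (deflate (0, 0) (mul r₁ r₂)) fixedBlock =
      rket (0, 0) (mul r₁ r₂) fixedBlock - μr • fixedBlock := by
    rw [rket_deflate]
    congr 2
    exact rket_basisVec_self _ _ _ _
  -- Deflation leaves the uncancelled scalar multiple $(\mu_l+\mu_r)\,ee$ of the fixed block. It is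
  -- absorbed into the upper half, and the product with $v+y$ which this creates is subtracted in
  -- the error.
  refine ⟨R, y + (μl + μr) • fixedRow, y,
    vst v y + vst y u - vst ((μl + μr) • fixedRow) (v + y) +
      (conjHL R T - (T - ket (0, 0) (deflate (0, 0) (mul l₁ l₂)) fixedBlock -
        rket (0, 0) (deflate (0, 0) (mul r₁ r₂)) fixedBlock)), ?_, ?_, hyn, ?_⟩
  · rw [hkl, hkr, hTe, hvu, ← vst_fixedRow]
    simp only [map_add, map_smul, LinearMap.add_apply, LinearMap.smul_apply, add_smul]
    abel
  · refine (norm_add_le _ _).trans ?_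
    rw [norm_smul, norm_fixedRow, mul_one, Real.norm_eq_abs]
    linarith
  · have hθ6 : (θ ^ 3) ^ 2 = η ^ 3 := by rw [← hθη]; ring
    have hη3 : 0 ≤ η ^ 3 := by positivity
    have f₁ : Factors (5 * θ ^ 3) (vst v y) :=
      Factors.of_vst _ injective_pair _ _ (by positivity) (by
        rw [mul_pow, hθ6]
        refine (mul_le_mul hvn hyn (norm_nonneg _) (by positivity)).trans ?_
        nlinarith)
    have f₂ : Factors (5 * θ ^ 3) (vst y u) :=
      Factors.of_vst _ injective_pair _ _ (by positivity) (by
        rw [mul_pow, hθ6]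
        refine (mul_le_mul hyn hun (norm_nonneg _) (by positivity)).trans ?_
        nlinarith)
    have hvy : ‖v + y‖ ≤ 13 * η := (norm_add_le _ _).trans (by nlinarith)
    have f₃ : Factors (6 * θ ^ 3) (vst ((μl + μr) • fixedRow) (v + y)) :=
      Factors.of_vst _ injective_pair _ _ (by positivity) (by
        rw [mul_pow, hθ6, norm_smul, norm_fixedRow, mul_one, Real.norm_eq_abs]
        refine (mul_le_mul hμ hvy (norm_nonneg _) (by positivity)).trans ?_
        nlinarith)
    refine (((f₁.add f₂).sub f₃).add est).mono ?_
    -- The total is $632=5+5+6+600+16$.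
    have h₄ : θ ^ 4 ≤ θ ^ 3 := pow_le_pow_of_le_one hθ0 hθ1 (by norm_num)
    have h₅ : 15 * (2 * η) * (20 * θ) + 4 * (2 * η) ^ 2 = 600 * θ ^ 3 + 16 * θ ^ 4 := by
      rw [← hθη]; ring
    linarith

/-- On tensors that are perturbed, to first order, in components with exactly one excited vertical
leg only, a type II step contracts the perturbation. -/
theorem exists_isTypeIIStep {J : HS ℕ ≃ₗᵢ[ℝ] HS (ℕ × ℕ)} (hJ : J (basisVec 0) = basisVec (0, 0))
    {t b w : Tensor4} {η : ℝ} (hη : η ≤ 1 / 2) (ht : OnTop 0 0 t)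
    (hb : OnBottom 0 0 b) (htn : ‖t‖ ≤ η) (hbn : ‖b‖ ≤ η) (hwn : ‖w‖ ≤ η ^ 2) :
    ∃ B : Tensor4, IsTypeIIStep J (fixedTensor + t + b + w) B ∧
      ‖B - fixedTensor‖ ≤ 10 ^ 6 * √η ^ 3 := by
  obtain ⟨R, x, y, E, hR, hx, hy, hE⟩ := exists_disentangler hη ht hb htn hbn hwn
  obtain ⟨X, Y, rfl, hX, hY⟩ := hE
  have hη0 : 0 ≤ η := (norm_nonneg _).trans htn
  set θ := √η with hθ
  have hθη : θ ^ 2 = η := Real.sq_sqrt hη0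
  have hθ0 : 0 ≤ θ := Real.sqrt_nonneg _
  have hθ1 : θ ≤ 1 := by nlinarith
  have h43 : η ^ 2 ≤ θ ^ 3 := by
    rw [← hθη, ← pow_mul]
    exact pow_le_pow_of_le_one hθ0 hθ1 (by norm_num)
  have h31 : θ ^ 3 ≤ 1 := pow_le_one₀ hθ0 hθ1
  have hinj := injective_two_mul.comp injective_pair
  rw [← vst_even_add_odd _ injective_pair] at hR
  have hun : ‖linearRow t‖ ≤ 2 * η := (norm_linearRow_le t).trans (by linarith)
  have hvn : ‖linearRow b‖ ≤ 2 * η := (norm_linearRow_le b).trans (by linarith)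
  -- One single bond carries both parts: even labels host the pair of bonds of the main product, odd
  -- labels the bond of the error.
  set Su := pushBottom (fun c : ℕ × ℕ => 2 * Nat.pair c.1 c.2) hinj
      (fixedRow + linearRow t + x) +
    pushBottom (fun c => 2 * c + 1) injective_two_mul_add_one X with hSu
  set Sd := pushTop (fun c : ℕ × ℕ => 2 * Nat.pair c.1 c.2) hinj
      (fixedRow + linearRow b + y) +
    pushTop (fun c => 2 * c + 1) injective_two_mul_add_one Y with hSd
  set u := pushBottom (fun c : ℕ × ℕ => 2 * Nat.pair c.1 c.2) hinj (linearRow t) with hu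
  set v := pushTop (fun c : ℕ × ℕ => 2 * Nat.pair c.1 c.2) hinj (linearRow b) with hv
  set zu := pushBottom (fun c : ℕ × ℕ => 2 * Nat.pair c.1 c.2) hinj x +
    pushBottom (fun c => 2 * c + 1) injective_two_mul_add_one X with hzu
  set zd := pushTop (fun c : ℕ × ℕ => 2 * Nat.pair c.1 c.2) hinj y +
    pushTop (fun c => 2 * c + 1) injective_two_mul_add_one Y with hzd
  set eu : UpperHalf := basisVec (0, (0, 0), 0, 0) with heu
  set ed : LowerHalf := basisVec (0, 0, 0, (0, 0)) with hed
  have hSu' : Su = eu + u + zu := by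
    have h : pushBottom (fun c : ℕ × ℕ => 2 * Nat.pair c.1 c.2) hinj fixedRow = eu :=
      pushBottom_basisVec _ _ _ _ _ _
    rw [hSu, map_add, map_add, h, hzu]
    abel
  have hSd' : Sd = ed + v + zd := by
    have h : pushTop (fun c : ℕ × ℕ => 2 * Nat.pair c.1 c.2) hinj fixedRow = ed :=
      pushTop_basisVec _ _ _ _ _ _
    rw [hSd, map_add, map_add, h, hzd]
    abel
  have hun' : ‖u‖ ≤ 2 * η := (norm_pushBottom _ _ _).trans_le hun
  have hvn' : ‖v‖ ≤ 2 * η := (norm_pushTop _ _ _).trans_le hvn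
  have hzun : ‖zu‖ ≤ 645 * θ ^ 3 := by
    refine (norm_add_le _ _).trans ?_
    rw [norm_pushBottom, norm_pushBottom]
    linarith
  have hzdn : ‖zd‖ ≤ 643 * θ ^ 3 := by
    refine (norm_add_le _ _).trans ?_
    rw [norm_pushTop, norm_pushTop]
    linarith
  have heun : ‖eu‖ = 1 := norm_basisVec _
  have hedn : ‖ed‖ = 1 := norm_basisVec _
  have hSun : ‖Su‖ ≤ 648 := by
    rw [hSu']
    refine norm_add₃_le.trans ?_
    rw [heun]
    linarith
  have hedv : ‖ed + v‖ ≤ 3 := by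
    refine (norm_add_le _ _).trans ?_
    rw [hedn]
    linarith
  -- In the exchanged order the linear terms vanish: $v$ has an excited bottom leg where $e$ has a
  -- trivial top leg, and $e$ has a trivial bottom leg where $u$ has an excited top leg.
  have hve : vst v eu = 0 := vst_eq_zero _ _ fun i j k c i' k' l => by
    by_cases hc : c = (0, 0)
    · left
      by_cases hj : j ∈ Set.range fun c : ℕ × ℕ => 2 * Nat.pair c.1 c.2
      · obtain ⟨p, rfl⟩ := hj
        exact (pushTop_apply _ hinj _ _ _ _ _).trans (hb.linearRow _ _ _ _ (Or.inr hc))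
      · exact pushTop_apply_of_notMem _ hinj _ _ _ _ _ hj
    · right
      rw [heu, basisVec_apply, if_neg]
      simp only [Prod.mk.injEq] at hc ⊢
      tauto
  have hue : vst ed u = 0 := vst_eq_zero _ _ fun i j k c i' k' l => by
    by_cases hc : c = (0, 0)
    · right
      by_cases hl : l ∈ Set.range fun c : ℕ × ℕ => 2 * Nat.pair c.1 c.2
      · obtain ⟨p, rfl⟩ := hl
        exact (pushBottom_apply _ hinj _ _ _ _ _).trans (ht.linearRow _ _ _ _ (Or.inl hc))
      · exact pushBottom_apply_of_notMem _ hinj _ _ _ _ _ hl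
    · left
      rw [hed, basisVec_apply, if_neg]
      simp only [Prod.mk.injEq] at hc ⊢
      tauto
  refine ⟨conjHL J.toContinuousLinearEquiv (vst Sd Su), ⟨R, Su, Sd, ?_, ?_⟩, ?_⟩
  · rw [block_coe, conjH_coe, hR]
    rfl
  · rw [stackDU_coe, conjH_coe]
  have hf : conjHL J.toContinuousLinearEquiv (vst ed eu) = fixedTensor := by
    rw [hed, heu, vst_basisVec, conjHL_basisVec hJ]
    rfl
  rw [← hf, ← conjHL_sub]
  refine (norm_conjHL_le J _).trans ?_
  have hdiff : vst Sd Su - vst ed eu = vst v u + vst zd Su + vst (ed + v) zu := by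
    rw [hSd', hSu']
    simp only [map_add, LinearMap.add_apply, hve, hue]
    abel
  rw [hdiff]
  have n₁ : ‖vst v u‖ ≤ 4 * η ^ 2 := (norm_vst_le _ _).trans
    ((mul_le_mul hvn' hun' (norm_nonneg _) (by positivity)).trans_eq (by ring))
  have n₂ : ‖vst zd Su‖ ≤ 643 * θ ^ 3 * 648 := (norm_vst_le _ _).trans
    (mul_le_mul hzdn hSun (norm_nonneg _) (by positivity))
  have n₃ : ‖vst (ed + v) zu‖ ≤ 3 * (645 * θ ^ 3) := (norm_vst_le _ _).trans
    (mul_le_mul hedv hzun (norm_nonneg _) (by positivity))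
  refine norm_add₃_le.trans ?_
  have : 0 ≤ θ ^ 3 := by positivity
  linarith

/-! ### One full renormalization step, its iteration, and the theorem. -/

open Function HS

/-- One step of the renormalization map, with its estimate. -/
theorem exists_isTensorRG {J₁ J₂ : HS ℕ ≃ₗᵢ[ℝ] HS (ℕ × ℕ)}
    (hJ₁ : J₁ (basisVec 0) = basisVec (0, 0)) (hJ₂ : J₂ (basisVec 0) = basisVec (0, 0))
    (A : Tensor4) (hA : A (0, 0, 0, 0) = 1) (hε : ‖A - fixedTensor‖ < 1 / (10 ^ 11) ^ 2) :
    ∃ B : Tensor4, IsTensorRG J₁ J₂ A B ∧ B (0, 0, 0, 0) = 1 ∧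
      ‖B - fixedTensor‖ ≤ 10 ^ 11 * ‖A - fixedTensor‖ ^ (3 / 2 : ℝ) := by
  set ε := ‖A - fixedTensor‖ with hεd
  have hε0 : 0 ≤ ε := norm_nonneg _
  have hε' : ε < 1 / 10 ^ 22 := by norm_num at hε ⊢; exact hε
  have hε1 : ε ≤ 1 := hε'.le.trans (by norm_num)
  obtain ⟨A₁, hg, hA₁, hA₁'⟩ := exists_isGaugeStep A hA hε1
  rw [← hεd] at hA₁ hA₁'
  obtain ⟨A₂, t, b, w, hI, hA₂, ht, hb, htn, hbn, hwn⟩ := exists_isTypeIStep hJ₁ A₁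
    (η := 22 * ε) (by linarith) hA₁ (hA₁'.trans (by nlinarith))
  -- Here $330=15\cdot 22$, and the second-order part satisfies $15\cdot 22^2\le 330^2$.
  obtain ⟨A₃, hII, hA₃⟩ := exists_isTypeIIStep hJ₂ (η := 330 * ε) (by linarith) ht hb
    (htn.trans (by linarith)) (hbn.trans (by linarith)) (hwn.trans (by nlinarith))
  rw [← hA₂] at hII
  set ξ := A₃ - fixedTensor with hξ
  have hpow : ε ^ (3 / 2 : ℝ) = √ε ^ 3 := by
    rw [Real.sqrt_eq_rpow, ← Real.rpow_natCast, ← Real.rpow_mul hε0]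
    norm_num
  have hs0 : 0 ≤ √ε := Real.sqrt_nonneg _
  have hs1 : √ε ≤ 1 / 10 ^ 11 := by
    rw [Real.sqrt_le_left (by norm_num)]
    exact hε'.le.trans (by norm_num)
  have hξn : ‖ξ‖ ≤ 10 ^ 6 * (6859 * √ε ^ 3) := by
    refine hA₃.trans (mul_le_mul_of_nonneg_left ?_ (by norm_num))
    have : √(330 * ε) ≤ 19 * √ε := by
      rw [Real.sqrt_le_left (by positivity), mul_pow, Real.sq_sqrt hε0]
      linarith
    calc √(330 * ε) ^ 3 ≤ (19 * √ε) ^ 3 := pow_le_pow_left₀ (Real.sqrt_nonneg _) this 3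
      _ = 6859 * √ε ^ 3 := by ring
  have hξ2 : ‖ξ‖ ≤ 1 / 2 := by
    have : √ε ^ 3 ≤ (1 / 10 ^ 11) ^ 3 := pow_le_pow_left₀ hs0 hs1 3
    norm_num at this hξn ⊢
    linarith
  have hξ0 := abs_apply_le ξ (0, 0, 0, 0)
  set x := ξ (0, 0, 0, 0) with hx
  have ha : A₃ (0, 0, 0, 0) = 1 + x := by
    rw [hx, hξ, HS.sub_apply, fixedTensor, basisVec_apply, if_pos rfl]
    ring
  have hx1 : 1 / 2 ≤ 1 + x := by
    have := neg_abs_le x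
    linarith
  have hne : A₃ (0, 0, 0, 0) ≠ 0 := by rw [ha]; linarith
  refine ⟨(A₃ (0, 0, 0, 0))⁻¹ • A₃, ⟨A₁, A₂, A₃, hg, hI, hII, hne, rfl⟩, ?_, ?_⟩
  · rw [HS.smul_apply, inv_mul_cancel₀ hne]
  · have e : (A₃ (0, 0, 0, 0))⁻¹ • A₃ - fixedTensor = (1 + x)⁻¹ • (ξ - x • fixedTensor) := by
      rw [← ha, eq_inv_smul_iff₀ hne, smul_sub, smul_inv_smul₀ hne, ha, hξ]
      module
    have h₁ : ‖(1 + x)⁻¹‖ ≤ 2 := by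
      rw [norm_inv, Real.norm_of_nonneg (by linarith)]
      exact inv_le_of_inv_le₀ (by norm_num) (by linarith)
    have h₂ : ‖ξ - x • fixedTensor‖ ≤ 2 * ‖ξ‖ := by
      refine (norm_sub_le _ _).trans ?_
      rw [norm_smul, norm_fixedTensor, Real.norm_eq_abs]
      linarith
    -- Normalization costs at most a factor $2\cdot 2$, and $4\cdot 10^6\cdot 6859\le 10^{11}$,
    -- which fixes the constant $C$.
    rw [e, norm_smul, hpow]
    refine (mul_le_mul h₁ h₂ (norm_nonneg _) (by norm_num)).trans ?_
    have : 0 ≤ √ε ^ 3 := by positivity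
    linarith

/-- The orbit of a map on `[0, C⁻²)` that contracts like `C x ^ (3/2)`. -/
theorem iterate_estimate {X : Type} (f : X → X) (P : X → Prop) (N : X → ℝ) {C : ℝ} (hC : 0 < C)
    (hN : ∀ a, 0 ≤ N a)
    (hf : ∀ a, P a → N a < 1 / C ^ 2 → P (f a) ∧ N (f a) ≤ C * N a ^ (3 / 2 : ℝ)) (a : X)
    (ha : P a) (hNa : N a < 1 / C ^ 2) (n : ℕ) :
    P (f^[n] a) ∧ N (f^[n] a) ≤ 1 / C ^ 2 * (C ^ 2 * N a) ^ ((3 / 2 : ℝ) ^ n) := by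
  have hC2 : 0 < C ^ 2 := by positivity
  have hy0 : 0 ≤ C ^ 2 * N a := mul_nonneg hC2.le (hN a)
  have hy1 : C ^ 2 * N a < 1 := by
    rw [lt_div_iff₀ hC2] at hNa
    linarith
  induction n with
  | zero =>
    refine ⟨ha, le_of_eq ?_⟩
    simp only [pow_zero, Real.rpow_one, iterate_zero, id]
    field_simp
  | succ n ih =>
    obtain ⟨hP, hb⟩ := ih
    set z := (C ^ 2 * N a) ^ ((3 / 2 : ℝ) ^ n) with hz
    have hz0 : 0 ≤ z := Real.rpow_nonneg hy0 _
    have hz1 : z < 1 := Real.rpow_lt_one hy0 hy1 (by positivity)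
    have hlt : N (f^[n] a) < 1 / C ^ 2 := hb.trans_lt (mul_lt_of_lt_one_right (by positivity) hz1)
    obtain ⟨hP', hb'⟩ := hf _ hP hlt
    rw [iterate_succ_apply']
    refine ⟨hP', hb'.trans ?_⟩
    calc C * N (f^[n] a) ^ (3 / 2 : ℝ) ≤ C * (1 / C ^ 2 * z) ^ (3 / 2 : ℝ) :=
          mul_le_mul_of_nonneg_left (Real.rpow_le_rpow (hN _) hb (by norm_num)) hC.le
      _ = C * ((1 / C ^ 2) ^ (3 / 2 : ℝ) * z ^ (3 / 2 : ℝ)) := by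
          rw [Real.mul_rpow (by positivity) hz0]
      _ = C * ((1 / C) ^ 3 * z ^ (3 / 2 : ℝ)) := by
          congr 2
          rw [one_div, one_div, ← inv_pow, ← Real.rpow_natCast, ← Real.rpow_mul (by positivity),
            ← Real.rpow_natCast]
          norm_num
      _ = 1 / C ^ 2 * z ^ (3 / 2 : ℝ) := by field_simp
      _ = 1 / C ^ 2 * (C ^ 2 * N a) ^ ((3 / 2 : ℝ) ^ (n + 1)) := by
          rw [hz, ← Real.rpow_mul hy0, pow_succ (3 / 2 : ℝ)]

/-- Super-exponential decay beats every geometric sequence. -/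
theorem tendsto_superexponential_div_pow {y q : ℝ} (hy0 : 0 ≤ y) (hy1 : y < 1) (hq : 0 < q) :
    Tendsto (fun n : ℕ => y ^ ((3 / 2 : ℝ) ^ n) / q ^ n) atTop (𝓝 0) := by
  rcases hy0.eq_or_lt with rfl | hy
  · refine tendsto_const_nhds.congr fun n => ?_
    rw [Real.zero_rpow (by positivity), zero_div]
  have hL : Real.log y < 0 := Real.log_neg hy hy1
  have hexp : ∀ n : ℕ, y ^ ((3 / 2 : ℝ) ^ n) / q ^ n =
      Real.exp (Real.log y * (3 / 2 : ℝ) ^ n - Real.log q * n) := fun n => by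
    rw [Real.rpow_def_of_pos hy, Real.exp_sub, mul_comm (Real.log q), Real.exp_nat_mul,
      Real.exp_log hq]
  simp only [hexp]
  refine Real.tendsto_exp_atBot.comp ?_
  have h₁ : Tendsto (fun n : ℕ => (n : ℝ) / (3 / 2 : ℝ) ^ n) atTop (𝓝 0) := by
    have := tendsto_pow_const_div_const_pow_of_one_lt 1 (r := (3 / 2 : ℝ)) (by norm_num)
    simpa using this
  -- With $(3/2)^n$ factored out of the exponent, the bracket tends to $\log y<0$, so the exponent
  -- tends to $-\infty$.
  have h₂ : Tendsto (fun n : ℕ => Real.log y - Real.log q * ((n : ℝ) / (3 / 2 : ℝ) ^ n)) atTop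
      (𝓝 (Real.log y)) := by
    simpa using tendsto_const_nhds.sub (h₁.const_mul (Real.log q))
  have h₃ := h₂.neg_mul_atTop hL (tendsto_pow_atTop_atTop_of_one_lt (r := (3 / 2 : ℝ))
    (by norm_num))
  refine h₃.congr fun n => ?_
  have : (3 / 2 : ℝ) ^ n ≠ 0 := by positivity
  field_simp

end

theorem theorem1 :
    ∃ C : ℝ, 0 < C ∧
      ∀ J₁ J₂ : HS ℕ ≃ₗᵢ[ℝ] HS (ℕ × ℕ),
        J₁ (basisVec 0) = basisVec (0, 0) → J₂ (basisVec 0) = basisVec (0, 0) →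
        ∃ RG : Tensor4 → Tensor4,
          ∀ A : Tensor4, A (0, 0, 0, 0) = 1 → ‖A - fixedTensor‖ < 1 / C ^ 2 →
            (IsTensorRG J₁ J₂ A (RG A) ∧ (RG A) (0, 0, 0, 0) = 1 ∧
              ‖RG A - fixedTensor‖ ≤ C * ‖A - fixedTensor‖ ^ (3 / 2 : ℝ)) ∧
            (∀ n : ℕ, ‖RG^[n] A - fixedTensor‖ ≤
              1 / C ^ 2 * (C ^ 2 * ‖A - fixedTensor‖) ^ ((3 / 2 : ℝ) ^ n)) ∧
            (∀ q : ℝ, 0 < q →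
              Tendsto (fun n : ℕ => ‖RG^[n] A - fixedTensor‖ / q ^ n) atTop (𝓝 0)) := by
  refine ⟨10 ^ 11, by norm_num, fun J₁ J₂ hJ₁ hJ₂ => ?_⟩
  have hex : ∀ A : Tensor4, ∃ B : Tensor4, A (0, 0, 0, 0) = 1 →
      ‖A - fixedTensor‖ < 1 / (10 ^ 11) ^ 2 → IsTensorRG J₁ J₂ A B ∧ B (0, 0, 0, 0) = 1 ∧
        ‖B - fixedTensor‖ ≤ 10 ^ 11 * ‖A - fixedTensor‖ ^ (3 / 2 : ℝ) := fun A => by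
    by_cases h : A (0, 0, 0, 0) = 1 ∧ ‖A - fixedTensor‖ < 1 / (10 ^ 11) ^ 2
    · obtain ⟨B, hB⟩ := exists_isTensorRG hJ₁ hJ₂ A h.1 h.2
      exact ⟨B, fun _ _ => hB⟩
    -- Outside the domain the value of the map is arbitrary.
    · exact ⟨A, fun h₁ h₂ => (h ⟨h₁, h₂⟩).elim⟩
  choose RG hRG using hex
  refine ⟨RG, fun A hA hAn => ?_⟩
  have hit : ∀ n : ℕ, ‖RG^[n] A - fixedTensor‖ ≤
      1 / (10 ^ 11) ^ 2 * ((10 ^ 11) ^ 2 * ‖A - fixedTensor‖) ^ ((3 / 2 : ℝ) ^ n) := fun n =>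
    (iterate_estimate RG (fun A => A (0, 0, 0, 0) = 1) (fun A => ‖A - fixedTensor‖)
      (C := 10 ^ 11) (by norm_num) (fun _ => norm_nonneg _)
      (fun a ha han => (hRG a ha han).2) A hA hAn n).2
  refine ⟨hRG A hA hAn, hit, fun q hq => ?_⟩
  have h₀ : 0 ≤ (10 ^ 11) ^ 2 * ‖A - fixedTensor‖ := by positivity
  have h₁ : (10 ^ 11) ^ 2 * ‖A - fixedTensor‖ < 1 := by
    rw [lt_div_iff₀ (by norm_num)] at hAn
    linarith
  have hlim := (tendsto_superexponential_div_pow h₀ h₁ hq).const_mul (1 / (10 ^ 11 : ℝ) ^ 2)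
  rw [mul_zero] at hlim
  refine squeeze_zero (fun n => by positivity) (fun n => ?_) hlim
  rw [← mul_div_assoc]
  exact div_le_div_of_nonneg_right (hit n) (by positivity)
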